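/- Let $R=\mathbb C[[u,v]]$ and let $f\in R$ be weighted homogeneous: there are positive rationals $w_u,w_v,d$ such that $aw_u+bw_v=d$ for every monomial $u^av^b$ appearing in $f$. Put $w_1=w_u/d$, $w_2=w_v/d$. Assume that $f$ defines an isolated plane curve singularity, i.e. the zero set of $(f,f_u,f_v)$ in $\operatorname{Spec}R$ is exactly the closed point. Let $A=R/(f)$, let $M_f=R/(f_u,f_v)$ be the Milnor algebra, and let $(M_f)_\lambda\subset M_f$ ($\lambda\in\mathbb Q$) be the subspace of classes of power series that are weighted homogeneous of degree $\lambda$ for the weights $w_1,w_2$. Let $S=R[\varepsilon]$, $|\varepsilon|=-1$, $\partial\varepsilon=f$, be the Koszul dg algebra resolution of $A$, and let $\Omega^\bullet_S$ be its de Rham algebra, formed with continuous differentials of $R$: the free graded-commutative $R$-algebra on $du,dv,\varepsilon$ (odd) and $d\varepsilon$ (even), with the internal differential $\partial$ (where $\partial(d\varepsilon)=-df$) and the de Rham differential $d_{\mathrm{dR}}$. Write $\gamma_m=(d\varepsilon)^m/m!$. The (continuous) cotangent complex of $A$ is $\mathbb L_A=\Omega^1_S\otimes_SA=[A\,d\varepsilon\to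 A\,du\oplus A\,dv]$ in degrees $-1,0$, and its derived exterior powers are $\bigwedge^q\mathbb L_A=\Omega^q_S\otimes_SA$. Then: 1. For all $q\ge 0$ the reduction map $\Omega^q_S\to\bigwedge^q\mathbb L_A$ is a quasi-isomorphism (so that $d_{\mathrm{dR}}$ induces maps $H^n(\bigwedge^q\mathbb L_A)\to H^n(\bigwedge^{q+1}\mathbb L_A)$), and $M_f=\bigoplus_\lambda (M_f)_\lambda$. 2. For every $p\ge1$ there are $R$-linear isomorphisms $$\theta:M_f\xrightarrow{\ \sim\ }H^{-p}\Bigl(\bigwedge\nolimits^{p+1}\mathbb L_A\Bigr),\quad [h]\mapsto[h\,(w_1u\,dv-w_2v\,du)\,\gamma_p],\qquad \eta:M_f\xrightarrow{\ \sim\ }H^{-p}\Bigl(\bigwedge\nolimits^{p+2}\mathbb L_A\Bigr),\quad [h]\mapsto[h\,du\wedge dv\,\gamma_p].$$ 3. For every $p\ge1$ the map $d_1:H^{-p}(\bigwedge^{p+1}\mathbb L_A)\to H^{-p}(\bigwedge^{p+2}\mathbb L_A)$ induced by the de Rham differential of $\Omega_S^\bullet$ is an isomorphism of $\mathbb C$-vector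 spaces, and under $\theta$ and $\eta$ it acts on $(M_f)_\lambda$ as the scalar $\lambda+w_1+w_2+p$. 4. For every $p\ge1$ the rule $[(a\,du+b\,dv)\gamma_p]\mapsto[(b_u-a_v)\,du\wedge dv\,\gamma_p]$, which differentiates only the coefficients of a form with coefficients in $A$, also gives a well-defined $\mathbb C$-linear isomorphism $H^{-p}(\bigwedge^{p+1}\mathbb L_A)\to H^{-p}(\bigwedge^{p+2}\mathbb L_A)$, and under $\theta$ and $\eta$ it acts on $(M_f)_\lambda$ as the scalar $\lambda+w_1+w_2$. -/

import Mathlib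

open Finset

noncomputable section

/-! ### Weighted homogeneous series, isolated plane curve singularities, Milnor algebra -/

/-- The ring `R = ℂ[[u, v]]`, with `u = X 0` and `v = X 1`. -/
abbrev PS2 : Type := MvPowerSeries (Fin 2) ℂ

namespace PS2

/-- The partial derivatives: `∂ 0 f = f_u` and `∂ 1 f = f_v`. -/
abbrev partialD (i : Fin 2) (f : PS2) : PS2 := MvPowerSeries.pderiv ℂ i f

/-- `f` is weighted homogeneous of weighted degree `d` for the weights `w`: every monomial
`u ^ a * v ^ b` that appears in `f` satisfies `a * w 0 + b * w 1 = d`. -/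
def IsWeightedHomogeneous (w : Fin 2 → ℚ) (d : ℚ) (f : PS2) : Prop :=
  ∀ a : Fin 2 →₀ ℕ, MvPowerSeries.coeff a f ≠ 0 → (a 0 : ℚ) * w 0 + (a 1 : ℚ) * w 1 = d

/-- The Jacobian ideal `(f_u, f_v)`. -/
def jacobianIdeal (f : PS2) : Ideal PS2 := Ideal.span {partialD 0 f, partialD 1 f}

/-- The Tjurina ideal `(f, f_u, f_v)`; it cuts out the singular locus of `f = 0`. -/
def tjurinaIdeal (f : PS2) : Ideal PS2 := Ideal.span {f, partialD 0 f, partialD 1 f}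

/-- `f` defines an isolated plane curve singularity: the singular locus of `f = 0`, the zero set
of `(f, f_u, f_v)`, consists of the closed point and nothing else. -/
def IsIsolatedSingularity (f : PS2) : Prop :=
  (tjurinaIdeal f).radical = IsLocalRing.maximalIdeal PS2

/-- The Milnor algebra `M_f = ℂ[[u, v]] / (f_u, f_v)`. -/
abbrev Milnor (f : PS2) : Type := PS2 ⧸ jacobianIdeal f

/-- The class of a power series in the Milnor algebra. -/
abbrev toMilnor (f h : PS2) : Milnor f := Ideal.Quotient.mk (jacobianIdeal f) h

/-- The weighted homogeneous power series of weighted degree `c`. -/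
def weightPiece (w : Fin 2 → ℚ) (c : ℚ) : Submodule ℂ PS2 where
  carrier := {h | IsWeightedHomogeneous w c h}
  zero_mem' := fun a ha => absurd (map_zero _) ha
  add_mem' := by
    intro x y hx hy a ha
    by_cases h : MvPowerSeries.coeff a x = 0
    · exact hy a (by simpa [h] using ha)
    · exact hx a h
  smul_mem' := by
    intro c x hx a ha
    exact hx a fun h => ha (by simp [h])

/-- The weight `c` piece `(M_f)_c` of the Milnor algebra: the classes of the weighted homogeneous
power series of weighted degree `c`. -/
def milnorPiece (f : PS2) (w : Fin 2 → ℚ) (c : ℚ) : Submodule ℂ (Milnor f) :=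
  (weightPiece w c).map (Ideal.Quotient.mkₐ ℂ (jacobianIdeal f)).toLinearMap

end PS2

/-! ### The de Rham algebra of the Koszul dg algebra

Let `S = R[ε]`, `|ε| = -1`, `∂ ε = f`, be the Koszul dg algebra resolution of `A = R / (f)`. Its
de Rham algebra `Ω_S` (with continuous differentials `du`, `dv` for the power series ring `R`) is
the free graded commutative `R`-algebra on `du`, `dv`, `ε` (odd) and `dε` (even); it carries the
`R`-linear internal differential `∂` and the `ℂ`-linear de Rham differential `d`.  These are the
derivations of odd total degree with

* `∂ r = 0`, `∂ ε = f`, `∂ (du) = ∂ (dv) = 0`, `∂ (dε) = - df = - (f_u du + f_v dv)`,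
* `d r = r_u du + r_v dv`, `d ε = dε`, `d (du) = d (dv) = d (dε) = 0`.

An `R`-basis of `Ω_S` is given by the products `e_I γ_m`, where `e_0 = du`, `e_1 = dv`, `e_2 = ε`,
`e_I` is the product of the `e_i`, `i ∈ I`, in increasing order, and `γ_m = (dε) ^ m / m!`. -/

namespace KoszulDeRham

open PS2

/-- Forms, written in the basis `e_I γ_m`: `ω I m` is the coefficient of `e_I γ_m`.  (No finiteness
in `m` is asked for, so this is the product of the modules `Ω^q_S`; each `Ω^q_S` has a finite
basis.) -/
abbrev Form : Type := Finset (Fin 3) → ℕ → PS2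

/-- The sign of moving `e_j` past the `e_i` with `i ∈ I`, `i < j`. -/
def sgn (j : Fin 3) (I : Finset (Fin 3)) : PS2 := (-1) ^ #{i ∈ I | i < j}

/-- Left multiplication `ω ↦ e_j ω`. -/
def wedge (j : Fin 3) : Form →ₗ[PS2] Form where
  toFun ω := fun I m => if j ∈ I then sgn j I * ω (I.erase j) m else 0
  map_add' x y := by
    funext I m
    by_cases h : j ∈ I <;> simp [h, mul_add]
  map_smul' r x := by
    funext I m
    by_cases h : j ∈ I <;> simp [h, mul_left_comm]

/-- Contraction `ι_j`: the odd derivation `∂/∂e_j`, i.e. `e_j e_I ↦ e_I` and `e_I ↦ 0` if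
`j ∉ I`. -/
def contract (j : Fin 3) : Form →ₗ[PS2] Form where
  toFun ω := fun I m => if j ∈ I then 0 else sgn j I * ω (insert j I) m
  map_add' x y := by
    funext I m
    by_cases h : j ∈ I <;> simp [h, mul_add]
  map_smul' r x := by
    funext I m
    by_cases h : j ∈ I <;> simp [h, mul_left_comm]

/-- The even derivation `∂/∂(dε)`: `γ_{m+1} ↦ γ_m`. -/
def derivDeps : Form →ₗ[PS2] Form where
  toFun ω := fun I m => ω I (m + 1)
  map_add' _ _ := rfl
  map_smul' _ _ := rfl

/-- Multiplication by `dε`: `γ_m ↦ (m + 1) γ_{m+1}`. -/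
def mulDeps : Form →ₗ[PS2] Form where
  toFun ω := fun I m => (m : PS2) * ω I (m - 1)
  map_add' x y := by
    funext I m
    simp [mul_add]
  map_smul' r x := by
    funext I m
    simp [mul_left_comm]

/-- Partial derivatives of the coefficients. -/
def coeffD (i : Fin 2) : Form →ₗ[ℂ] Form where
  toFun ω := fun I m => partialD i (ω I m)
  map_add' x y := by
    funext I m
    simp
  map_smul' r x := by
    funext I m
    simp

/-- The internal differential `∂ = f ∂/∂ε - df ∂/∂(dε)` of `Ω_S`. -/
def del (f : PS2) : Form →ₗ[PS2] Form :=
  f • contract 2 -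
    (partialD 0 f • (wedge 0 ∘ₗ derivDeps) + partialD 1 f • (wedge 1 ∘ₗ derivDeps))

/-- The de Rham differential `d = dε ∂/∂ε + du ∂/∂u + dv ∂/∂v` of `Ω_S`. -/
def dR : Form →ₗ[ℂ] Form :=
  (mulDeps ∘ₗ contract 2).restrictScalars ℂ +
    ((wedge 0).restrictScalars ℂ ∘ₗ coeffD 0 + (wedge 1).restrictScalars ℂ ∘ₗ coeffD 1)

/-- The form degree of `e_I γ_m`. -/
def formDeg (I : Finset (Fin 3)) (m : ℕ) : ℕ := #(I.erase 2) + m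

/-- The cohomological degree of `e_I γ_m`. -/
def cohDeg (I : Finset (Fin 3)) (m : ℕ) : ℤ := -((if 2 ∈ I then 1 else 0) + (m : ℤ))

/-- The part `Ω^{q,n}_S` of form degree `q` and cohomological degree `n`. -/
def piece (q : ℕ) (n : ℤ) : Submodule PS2 Form where
  carrier := {ω | ∀ I m, ω I m ≠ 0 → formDeg I m = q ∧ cohDeg I m = n}
  zero_mem' := fun I m h => absurd rfl h
  add_mem' := by
    intro x y hx hy I m h
    by_cases h0 : x I m = 0
    · exact hy I m (by simpa [h0] using h)
    · exact hx I m h0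
  smul_mem' := by
    intro c x hx I m h
    exact hx I m fun h0 => h (by simp [h0])

/-- The form `r e_I γ_m`. -/
def mono (I : Finset (Fin 3)) (m : ℕ) (r : PS2) : Form := Pi.single I (Pi.single m r)

theorem subset_cases (I : Finset (Fin 3)) :
    I = ∅ ∨ I = {0} ∨ I = {1} ∨ I = {0, 1} ∨ I = {2} ∨ I = {0, 2} ∨ I = {1, 2} ∨ I = {0, 1, 2} := by
  revert I; decide


theorem sgn_zero (I : Finset (Fin 3)) : sgn 0 I = 1 := by
  simp [sgn]

theorem sgn_one (I : Finset (Fin 3)) : sgn 1 I = if 0 ∈ I then -1 else 1 := by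
  have h : #{i ∈ I | i < 1} = if 0 ∈ I then 1 else 0 := by revert I; decide
  rw [sgn, h]
  split_ifs <;> simp

theorem sgn_two (I : Finset (Fin 3)) :
    sgn 2 I = (if 0 ∈ I then -1 else 1) * (if 1 ∈ I then -1 else 1) := by
  have h : #{i ∈ I | i < 2} = (if 0 ∈ I then 1 else 0) + if 1 ∈ I then 1 else 0 := by
    revert I; decide
  rw [sgn, h]
  split_ifs <;> simp

theorem wedge_wedge (ω : Form) : wedge 1 (wedge 0 ω) = -wedge 0 (wedge 1 ω) := by
  funext I m
  by_cases h0 : 0 ∈ I <;> by_cases h1 : 1 ∈ I <;>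
    simp [wedge, sgn_zero, sgn_one, h0, h1, Finset.erase_right_comm]

theorem wedge_self (j : Fin 3) (ω : Form) : wedge j (wedge j ω) = 0 := by
  funext I m
  simp [wedge]

theorem contract_self (j : Fin 3) (ω : Form) : contract j (contract j ω) = 0 := by
  funext I m
  simp [contract]

theorem contract_wedge_zero (ω : Form) : contract 2 (wedge 0 ω) = -wedge 0 (contract 2 ω) := by
  funext I m
  by_cases h0 : 0 ∈ I <;> by_cases h1 : 1 ∈ I <;> by_cases h2 : 2 ∈ I <;>
    simp [wedge, contract, sgn_zero, sgn_two, h0, h1, h2, Finset.erase_insert_of_ne]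

theorem contract_wedge_one (ω : Form) : contract 2 (wedge 1 ω) = -wedge 1 (contract 2 ω) := by
  funext I m
  by_cases h0 : 0 ∈ I <;> by_cases h1 : 1 ∈ I <;> by_cases h2 : 2 ∈ I <;>
    simp [wedge, contract, sgn_one, sgn_two, h0, h1, h2, Finset.erase_insert_of_ne]

theorem partialD_comm (h : PS2) : partialD 1 (partialD 0 h) = partialD 0 (partialD 1 h) := by
  ext a
  simp only [partialD, MvPowerSeries.coeff_pderiv]
  simp [add_right_comm a, mul_right_comm]

theorem coeffD_smul (i : Fin 2) (r : PS2) (ω : Form) :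
    coeffD i (r • ω) = r • coeffD i ω + partialD i r • ω := by
  funext I m
  simp [coeffD, mul_comm]

theorem coeffD_comm (ω : Form) : coeffD 1 (coeffD 0 ω) = coeffD 0 (coeffD 1 ω) := by
  funext I m
  exact partialD_comm _

theorem partialD_sgn (i : Fin 2) (j : Fin 3) (I : Finset (Fin 3)) (x : PS2) :
    partialD i (sgn j I * x) = sgn j I * partialD i x := by
  rcases neg_one_pow_eq_or PS2 #{k ∈ I | k < j} with h | h <;> simp [sgn, h]

theorem coeffD_wedge (i : Fin 2) (j : Fin 3) (ω : Form) :
    coeffD i (wedge j ω) = wedge j (coeffD i ω) := by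
  funext I m
  by_cases h : j ∈ I
  · simpa [coeffD, wedge, h] using partialD_sgn i j _ _
  · simp [coeffD, wedge, h]

theorem coeffD_contract (i : Fin 2) (j : Fin 3) (ω : Form) :
    coeffD i (contract j ω) = contract j (coeffD i ω) := by
  funext I m
  by_cases h : j ∈ I
  · simp [coeffD, contract, h]
  · simpa [coeffD, contract, h] using partialD_sgn i j _ _

theorem coeffD_derivDeps (i : Fin 2) (ω : Form) :
    coeffD i (derivDeps ω) = derivDeps (coeffD i ω) := rfl

theorem coeffD_mulDeps (i : Fin 2) (ω : Form) :
    coeffD i (mulDeps ω) = mulDeps (coeffD i ω) := by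
  funext I m
  simp [coeffD, mulDeps]

theorem derivDeps_mulDeps (ω : Form) :
    derivDeps (mulDeps ω) = mulDeps (derivDeps ω) + ω := by
  funext I m
  rcases m with _ | m <;> simp [derivDeps, mulDeps, add_mul, add_comm]

theorem wedge_derivDeps (j : Fin 3) (ω : Form) :
    wedge j (derivDeps ω) = derivDeps (wedge j ω) := rfl

theorem contract_derivDeps (j : Fin 3) (ω : Form) :
    contract j (derivDeps ω) = derivDeps (contract j ω) := rfl

theorem wedge_mulDeps (j : Fin 3) (ω : Form) :
    wedge j (mulDeps ω) = mulDeps (wedge j ω) := by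
  funext I m
  by_cases h : j ∈ I <;> simp [mulDeps, wedge, h, mul_left_comm]

theorem contract_mulDeps (j : Fin 3) (ω : Form) :
    contract j (mulDeps ω) = mulDeps (contract j ω) := by
  funext I m
  by_cases h : j ∈ I <;> simp [mulDeps, contract, h, mul_left_comm]

theorem del_apply (f : PS2) (ω : Form) : del f ω = f • contract 2 ω -
    (partialD 0 f • wedge 0 (derivDeps ω) + partialD 1 f • wedge 1 (derivDeps ω)) := rfl

theorem dR_apply (ω : Form) : dR ω = mulDeps (contract 2 ω) +
    (wedge 0 (coeffD 0 ω) + wedge 1 (coeffD 1 ω)) := rfl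

theorem del_del (f : PS2) (ω : Form) : del f (del f ω) = 0 := by
  simp only [del_apply, map_add, map_sub, map_smul, wedge_derivDeps, contract_derivDeps, wedge_self,
    contract_self, wedge_wedge, contract_wedge_zero, contract_wedge_one, map_neg, map_zero,
    smul_add, smul_sub, smul_neg, smul_zero, smul_smul, mul_comm]
  abel

theorem dR_dR (ω : Form) : dR (dR ω) = 0 := by
  simp only [dR_apply, map_add, map_neg, map_zero, wedge_self, contract_self, wedge_wedge,
    contract_wedge_zero, contract_wedge_one, coeffD_wedge, coeffD_contract, coeffD_mulDeps,
    wedge_mulDeps, contract_mulDeps, coeffD_comm]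
  abel

theorem dR_del (f : PS2) (ω : Form) : dR (del f ω) = -del f (dR ω) := by
  simp only [dR_apply, del_apply, map_add, map_sub, map_neg, map_smul, map_zero, wedge_self,
    contract_self, wedge_wedge, contract_wedge_zero, contract_wedge_one, coeffD_wedge,
    coeffD_contract, coeffD_derivDeps, wedge_mulDeps, contract_mulDeps, coeffD_smul, wedge_derivDeps, contract_derivDeps, derivDeps_mulDeps, partialD_comm f,
    smul_add, smul_neg, smul_zero, neg_add_rev, neg_sub]
  abel

theorem contract_piece {q : ℕ} {n : ℤ} {ω : Form} (h : ω ∈ piece q n) :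
    contract 2 ω ∈ piece q (n + 1) := by
  intro I m hI
  by_cases h2 : 2 ∈ I
  · simp [contract, h2] at hI
  · obtain ⟨h3, h4⟩ := h (insert 2 I) m fun h0 => hI (by simp [contract, h2, h0])
    simp [formDeg, cohDeg, h2] at h3 h4 ⊢
    omega

theorem wedge_piece {j : Fin 3} (hj : j ≠ 2) {q : ℕ} {n : ℤ} {ω : Form} (h : ω ∈ piece q n) :
    wedge j ω ∈ piece (q + 1) n := by
  intro I m hI
  by_cases h2 : j ∈ I
  · obtain ⟨h3, h4⟩ := h (I.erase j) m fun h0 => hI (by simp [wedge, h2, h0])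
    have h5 : #((I.erase j).erase 2) + 1 = #(I.erase 2) := by
      rw [Finset.erase_right_comm]
      exact Finset.card_erase_add_one (by simp [h2, hj])
    simp [formDeg, cohDeg, hj.symm] at h3 h4 ⊢
    omega
  · simp [wedge, h2] at hI

theorem derivDeps_wedge_piece {j : Fin 3} (hj : j ≠ 2) {q : ℕ} {n : ℤ} {ω : Form}
    (h : ω ∈ piece q n) : wedge j (derivDeps ω) ∈ piece q (n + 1) := by
  intro I m hI
  obtain ⟨h3, h4⟩ := wedge_piece hj h I (m + 1) hI
  simp [formDeg, cohDeg] at h3 h4 ⊢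
  omega

theorem mulDeps_piece {q : ℕ} {n : ℤ} {ω : Form} (h : ω ∈ piece q (n + 1)) :
    mulDeps ω ∈ piece (q + 1) n := by
  intro I m hI
  rcases m with _ | m
  · simp [mulDeps] at hI
  · obtain ⟨h3, h4⟩ := h I m fun h0 => hI (by simp [mulDeps, h0])
    simp [formDeg, cohDeg] at h3 h4 ⊢
    omega

theorem coeffD_piece (i : Fin 2) {q : ℕ} {n : ℤ} {ω : Form} (h : ω ∈ piece q n) :
    coeffD i ω ∈ piece q n :=
  fun I m hI => h I m fun h0 => hI (by simp [coeffD, h0])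

theorem del_piece (f : PS2) {q : ℕ} {n : ℤ} {ω : Form} (h : ω ∈ piece q n) :
    del f ω ∈ piece q (n + 1) := by
  rw [del_apply]
  exact sub_mem (Submodule.smul_mem _ _ (contract_piece h)) (add_mem
    (Submodule.smul_mem _ _ (derivDeps_wedge_piece (by decide) h))
    (Submodule.smul_mem _ _ (derivDeps_wedge_piece (by decide) h)))

theorem dR_piece {q : ℕ} {n : ℤ} {ω : Form} (h : ω ∈ piece q n) : dR ω ∈ piece (q + 1) n := by
  rw [dR_apply]
  exact add_mem (mulDeps_piece (contract_piece h)) (add_mem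
    (wedge_piece (by decide) (coeffD_piece 0 h)) (wedge_piece (by decide) (coeffD_piece 1 h)))

/-! ### Cohomology, the exterior powers of the cotangent complex, the de Rham differential -/

section Cohomology

variable {M : Type*} [AddCommGroup M] [Module PS2 M]

/-- Cocycles of degree `n` in a graded module `gr` with differential `D` of degree `1`. -/
def cocycles (D : M →ₗ[PS2] M) (gr : ℤ → Submodule PS2 M) (n : ℤ) : Submodule PS2 M :=
  gr n ⊓ LinearMap.ker D

/-- Coboundaries of degree `n`, as a submodule of the cocycles. -/
def coboundaries (D : M →ₗ[PS2] M) (gr : ℤ → Submodule PS2 M) (n : ℤ) :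
    Submodule PS2 (cocycles D gr n) :=
  ((gr (n - 1)).map D).submoduleOf (cocycles D gr n)

/-- The `n`-th cohomology `H^n`. -/
abbrev Cohomology (D : M →ₗ[PS2] M) (gr : ℤ → Submodule PS2 M) (n : ℤ) : Type _ :=
  cocycles D gr n ⧸ coboundaries D gr n

end Cohomology

/-- The cohomology `H^n(Ω^q_S)` of the complex of `q`-forms `Ω^q_S` with differential `∂`. -/
abbrev HForm (f : PS2) (q : ℕ) (n : ℤ) : Type := Cohomology (del f) (piece q) n

/-- The dg ideal `(f, ε) Ω_S`, so that `Ω_S / (f, ε) Ω_S = Ω_S ⊗_S A`. -/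
def dgIdeal (f : PS2) : Submodule PS2 Form where
  carrier := {ω | ∀ I, 2 ∉ I → ∀ m, f ∣ ω I m}
  zero_mem' := fun _ _ _ => dvd_zero _
  add_mem' := fun hx hy I hI m => dvd_add (hx I hI m) (hy I hI m)
  smul_mem' := fun c _ hx I hI m => Dvd.dvd.mul_left (hx I hI m) c

theorem wedge_dgIdeal {f : PS2} {j : Fin 3} {ω : Form} (h : ω ∈ dgIdeal f) :
    wedge j ω ∈ dgIdeal f := by
  intro I hI m
  by_cases hj : j ∈ I
  · simpa [wedge, hj] using Dvd.dvd.mul_left (h (I.erase j) (by simp [hI]) m) _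
  · simp [wedge, hj]

theorem del_dgIdeal (f : PS2) : dgIdeal f ≤ (dgIdeal f).comap (del f) := by
  intro ω h
  have h1 : derivDeps ω ∈ dgIdeal f := fun I hI m => h I hI (m + 1)
  have h2 : f • contract 2 ω ∈ dgIdeal f := fun I _ m => Dvd.intro _ rfl
  rw [Submodule.mem_comap, del_apply]
  exact sub_mem h2 (add_mem (Submodule.smul_mem _ _ (wedge_dgIdeal h1))
    (Submodule.smul_mem _ _ (wedge_dgIdeal h1)))

/-- `Ω_S ⊗_S A`.  Its part of form degree `1` is the cotangent complex
`L_A = Ω^1_S ⊗_S A = [A dε → A du ⊕ A dv]` in degrees `-1, 0`; its part of form degree `q` is the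
`q`-th exterior power over `A` of the complex `L_A` of free `A`-modules, i.e. the derived exterior
power `⋀^q L_A`. -/
abbrev FormA (f : PS2) : Type := Form ⧸ dgIdeal f

/-- The differential of `Ω_S ⊗_S A`. -/
def delA (f : PS2) : FormA f →ₗ[PS2] FormA f := (dgIdeal f).mapQ (dgIdeal f) (del f) (del_dgIdeal f)

/-- The part of cohomological degree `n` of `⋀^q L_A`. -/
def pieceA (f : PS2) (q : ℕ) (n : ℤ) : Submodule PS2 (FormA f) := (piece q n).map (dgIdeal f).mkQ

/-- The cohomology `H^n(⋀^q L_A)`. -/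
abbrev HExt (f : PS2) (q : ℕ) (n : ℤ) : Type := Cohomology (delA f) (pieceA f q) n

/-- The reduction map `H^n(Ω^q_S) → H^n(Ω^q_S ⊗_S A) = H^n(⋀^q L_A)`. -/
def red (f : PS2) (q : ℕ) (n : ℤ) : HForm f q n →ₗ[PS2] HExt f q n :=
  (coboundaries (del f) (piece q) n).mapQ (coboundaries (delA f) (pieceA f q) n)
    ((dgIdeal f).mkQ.restrict fun x hx => by
      obtain ⟨h1, h2⟩ := hx
      refine ⟨Submodule.mem_map_of_mem h1, ?_⟩
      have h3 : del f x = 0 := h2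
      simp [delA, h3])
    (by
      rintro ⟨x, hx⟩ ⟨y, hy, hyx⟩
      refine ⟨(dgIdeal f).mkQ y, Submodule.mem_map_of_mem hy, ?_⟩
      have h3 : del f y = x := hyx
      exact congrArg (dgIdeal f).mkQ h3)

/-- The `ℂ`-linear map `H^n(Ω^q_S) → H^n(Ω^{q+1}_S)` induced by the de Rham differential. -/
def dRH (f : PS2) (q : ℕ) (n : ℤ) : HForm f q n →ₗ[ℂ] HForm f (q + 1) n :=
  (Submodule.Quotient.restrictScalarsEquiv ℂ (coboundaries (del f) (piece (q + 1)) n)).toLinearMap ∘ₗ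
  ((coboundaries (del f) (piece q) n).restrictScalars ℂ).mapQ
    ((coboundaries (del f) (piece (q + 1)) n).restrictScalars ℂ)
    (dR.restrict (p := (cocycles (del f) (piece q) n).restrictScalars ℂ)
      (q := (cocycles (del f) (piece (q + 1)) n).restrictScalars ℂ) fun x hx => by
      obtain ⟨h1, h2⟩ := hx
      have h3 : del f x = 0 := h2
      have h4 := dR_del f x
      rw [h3, map_zero, zero_eq_neg] at h4
      exact ⟨dR_piece h1, h4⟩)
    (by
      rintro ⟨x, hx⟩ ⟨y, hy, hyx⟩
      have h3 : del f y = x := hyx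
      refine ⟨-dR y, neg_mem (dR_piece hy), ?_⟩
      have h4 : del f (-dR y) = dR x := by rw [map_neg, ← dR_del, h3]
      exact h4) ∘ₗ
  (Submodule.Quotient.restrictScalarsEquiv ℂ (coboundaries (del f) (piece q) n)).symm.toLinearMap

/-- The form `ω` over `S` (or rather its image in `Ω_S ⊗_S A`) is a cocycle, and its class in
`H^n(⋀^q L_A)` is `x`. -/
def Represents (f : PS2) (q : ℕ) (n : ℤ) (ω : Form) (x : HExt f q n) : Prop :=
  ∃ z : cocycles (delA f) (pieceA f q) n, (z : FormA f) = (dgIdeal f).mkQ ω ∧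
    (coboundaries (delA f) (pieceA f q) n).mkQ z = x

/-- The form `(a du + b dv) γ_m`. -/
def oneForm (a b : PS2) (m : ℕ) : Form := mono {0} m a + mono {1} m b

/-- The form `h du dv γ_m`. -/
def twoForm (h : PS2) (m : ℕ) : Form := mono {0, 1} m h

end KoszulDeRham

end

open PS2 KoszulDeRham

noncomputable section

/-! ### The Euler operator -/

namespace PS2

/-! Let E = w₁ u ∂/∂u + w₂ v ∂/∂v (`euler`). It is diagonal on monomials, the eigenvalue being the
weight, so Ef = f. Hence f lies in J = (f_u, f_v), the Tjurina and Jacobian ideals agree, and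
isolatedness puts some u^N and v^N into J. This has two consequences. Every syzygy of (f_u, f_v) is
a multiple of the obvious one (`exists_eq_mul_of_syzygy`). And M_f is spanned by finitely many
monomials, so it is the sum of its weight pieces; these are independent because they lie in
eigenspaces of E for distinct eigenvalues.

Modulo (f, ε), for q ≥ 2, the complex of q-forms is A γ_q → (A du ⊕ A dv) γ_{q-1} → A du dv γ_{q-2},
with differential -df ∧ ∂/∂(dε). At the right end the cohomology is A/J = M_f, because f ∈ J
(`exists_eta`). In the middle put α = w₁ u dv - w₂ v du. Then df ∧ α = (Ef) du dv = f du dv, so each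
hα γ_p is a cocycle over A. Conversely, if df ∧ ξ = k f du dv, then ξ - kα is killed by df, hence is
a multiple of df and a coboundary. Finally hα γ_p is a coboundary exactly when h ∈ J
(`exists_theta`).

The reduction is a quasi-isomorphism because the dg ideal (f, ε) is acyclic
(`exists_del_eq_of_mem_dgIdeal`), so the de Rham differential is computed on lifts. The ∂-cocycle hα
γ_p + h du dv ε γ_{p-1} lifts hα γ_p. Here d(hα) = (E + w₁ + w₂)h du dv, and the ε-term contributes
ph du dv γ_p (`represents_red_dRH`). Differentiating only coefficients skips the lift and loses the
summand p. Both operators E + s with s > 0 are bijective on M_f, since its weights are nonnegative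
(`milnorEuler_bijective`). -/

open MvPowerSeries in
theorem coeff_X_mul_partialD (i : Fin 2) (h : PS2) (m : Fin 2 →₀ ℕ) :
    coeff m (X i * partialD i h) = (m i : ℂ) * coeff m h := by
  rw [X, coeff_monomial_mul]
  split_ifs with hm
  · have hi : 1 ≤ m i := by simpa using hm i
    rw [partialD, coeff_pderiv, tsub_add_cancel_of_le hm, one_mul, mul_comm]
    congr 1
    simp [Nat.cast_sub hi]
  · have hi : m i = 0 := by
      by_contra h0
      exact hm (by simpa [Finsupp.single_le_iff] using Nat.one_le_iff_ne_zero.2 h0)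
    simp [hi]

theorem partialD_smul (i : Fin 2) (c : ℂ) (h : PS2) : partialD i (c • h) = c • partialD i h :=
  Derivation.map_smul _ c h

theorem partialD_add (i : Fin 2) (g h : PS2) :
    partialD i (g + h) = partialD i g + partialD i h :=
  map_add _ g h

theorem partialD_neg (i : Fin 2) (h : PS2) : partialD i (-h) = -partialD i h :=
  map_neg _ h

theorem partialD_mul (i : Fin 2) (g h : PS2) :
    partialD i (g * h) = g * partialD i h + h * partialD i g :=
  Derivation.leibniz _ g h

/-- The Euler operator `a u ∂/∂u + b v ∂/∂v`. -/
def euler (a b : ℂ) : PS2 →ₗ[ℂ] PS2 where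
  toFun h := a • (MvPowerSeries.X 0 * partialD 0 h) + b • (MvPowerSeries.X 1 * partialD 1 h)
  map_add' x y := by simp only [map_add, mul_add, smul_add]; abel
  map_smul' c x := by
    simp only [partialD_smul, mul_smul_comm, smul_add, smul_comm c, RingHom.id_apply]

theorem euler_apply (a b : ℂ) (h : PS2) : euler a b h =
    a • (MvPowerSeries.X 0 * partialD 0 h) + b • (MvPowerSeries.X 1 * partialD 1 h) := rfl

theorem coeff_euler (a b : ℂ) (h : PS2) (m : Fin 2 →₀ ℕ) :
    MvPowerSeries.coeff m (euler a b h) = (m 0 * a + m 1 * b) * MvPowerSeries.coeff m h := by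
  rw [euler_apply, map_add, map_smul, map_smul, coeff_X_mul_partialD, coeff_X_mul_partialD,
    smul_eq_mul, smul_eq_mul]
  ring

theorem euler_mul (a b : ℂ) (g h : PS2) :
    euler a b (g * h) = g * euler a b h + h * euler a b g := by
  simp only [euler_apply, partialD_mul, MvPowerSeries.smul_eq_C_mul]
  ring

theorem IsWeightedHomogeneous.euler_eq {w₁ w₂ c : ℚ} {h : PS2}
    (hh : IsWeightedHomogeneous ![w₁, w₂] c h) : euler w₁ w₂ h = (c : ℂ) • h := by
  ext m
  rw [coeff_euler, map_smul, smul_eq_mul]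
  by_cases h0 : MvPowerSeries.coeff m h = 0
  · simp [h0]
  · rw [← hh m h0]
    simp

/-- Differentiate Ef = f: since [∂/∂u, E] = a ∂/∂u, the partial f_u has weight 1 - a. This makes J
stable under E. -/
theorem euler_partialD_zero {a b : ℂ} {f : PS2} (hf : euler a b f = f) :
    euler a b (partialD 0 f) = (1 - a) • partialD 0 f := by
  have h := congrArg (partialD 0) hf
  have h0 : partialD 0 (MvPowerSeries.X 0 : PS2) = 1 := MvPowerSeries.pderiv_X_self
  have h1 : partialD 0 (MvPowerSeries.X 1 : PS2) = 0 := MvPowerSeries.pderiv_X_of_ne (by decide)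
  simp only [euler_apply, map_add, partialD_smul, partialD_mul, h0, h1] at h
  rw [euler_apply, partialD_comm, sub_smul, one_smul]
  simp only [MvPowerSeries.smul_eq_C_mul] at h ⊢
  linear_combination h

theorem euler_partialD_one {a b : ℂ} {f : PS2} (hf : euler a b f = f) :
    euler a b (partialD 1 f) = (1 - b) • partialD 1 f := by
  have h := congrArg (partialD 1) hf
  have h0 : partialD 1 (MvPowerSeries.X 1 : PS2) = 1 := MvPowerSeries.pderiv_X_self
  have h1 : partialD 1 (MvPowerSeries.X 0 : PS2) = 0 := MvPowerSeries.pderiv_X_of_ne (by decide)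
  simp only [euler_apply, map_add, partialD_smul, partialD_mul, h0, h1] at h
  rw [euler_apply, ← partialD_comm, sub_smul, one_smul]
  simp only [MvPowerSeries.smul_eq_C_mul] at h ⊢
  linear_combination h

/-! ### The Jacobian ideal of a weighted homogeneous singularity -/

theorem mem_jacobianIdeal {f h : PS2} :
    h ∈ jacobianIdeal f ↔ ∃ a b, a * partialD 0 f + b * partialD 1 f = h :=
  Ideal.mem_span_pair

theorem partialD_mem_jacobianIdeal (i : Fin 2) (f : PS2) : partialD i f ∈ jacobianIdeal f := by
  refine Ideal.subset_span ?_
  fin_cases i <;> simp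

theorem euler_mem_jacobianIdeal {a b : ℂ} {f : PS2} (hf : euler a b f = f) {h : PS2}
    (hh : h ∈ jacobianIdeal f) : euler a b h ∈ jacobianIdeal f := by
  obtain ⟨x, y, rfl⟩ := mem_jacobianIdeal.1 hh
  rw [mem_jacobianIdeal, map_add, euler_mul, euler_mul, euler_partialD_zero hf,
    euler_partialD_one hf]
  refine ⟨euler a b x + (1 - a) • x, euler a b y + (1 - b) • y, ?_⟩
  simp only [MvPowerSeries.smul_eq_C_mul]
  ring

theorem mem_jacobianIdeal_of_euler {a b : ℂ} {f : PS2} (hf : euler a b f = f) :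
    f ∈ jacobianIdeal f := by
  rw [mem_jacobianIdeal]
  refine ⟨a • MvPowerSeries.X 0, b • MvPowerSeries.X 1, ?_⟩
  conv_rhs => rw [← hf, euler_apply]
  rw [smul_mul_assoc, smul_mul_assoc]

theorem IsIsolatedSingularity.exists_X_pow_mem {f : PS2} (hs : IsIsolatedSingularity f)
    (hf : f ∈ jacobianIdeal f) :
    ∃ N : ℕ, ∀ i : Fin 2, (MvPowerSeries.X i : PS2) ^ N ∈ jacobianIdeal f := by
  have hle : tjurinaIdeal f ≤ jacobianIdeal f := by
    rw [tjurinaIdeal, Ideal.span_le]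
    rintro x (rfl | rfl | rfl)
    · exact hf
    · exact partialD_mem_jacobianIdeal 0 f
    · exact partialD_mem_jacobianIdeal 1 f
  have key (i : Fin 2) : ∃ n : ℕ, (MvPowerSeries.X i : PS2) ^ n ∈ jacobianIdeal f := by
    have hX : (MvPowerSeries.X i : PS2) ∈ (tjurinaIdeal f).radical := by
      rw [hs, IsLocalRing.mem_maximalIdeal, mem_nonunits_iff,
        MvPowerSeries.isUnit_iff_constantCoeff]
      simp
    obtain ⟨n, hn⟩ := hX
    exact ⟨n, hle hn⟩
  obtain ⟨n₀, h₀⟩ := key 0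
  obtain ⟨n₁, h₁⟩ := key 1
  refine ⟨max n₀ n₁, fun i => ?_⟩
  fin_cases i
  · exact Ideal.pow_mem_of_pow_mem _ h₀ (le_max_left _ _)
  · exact Ideal.pow_mem_of_pow_mem _ h₁ (le_max_right _ _)

/-! ### Triviality of syzygies -/

theorem X_pow_dvd_of_dvd_mul {N : ℕ} {c : PS2}
    (h : (MvPowerSeries.X 0 : PS2) ^ N ∣ c * MvPowerSeries.X 1 ^ N) :
    (MvPowerSeries.X 0 : PS2) ^ N ∣ c := by
  rw [MvPowerSeries.X_pow_dvd_iff] at h ⊢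
  intro m hm
  -- Multiplication by v^N shifts exponents without changing the power of u.
  have h1 := h (m + Finsupp.single 1 N) (by simpa using hm)
  rwa [MvPowerSeries.X_pow_eq, MvPowerSeries.coeff_add_mul_monomial, mul_one] at h1

/-- If the ideal `(g₀, g₁)` contains `u ^ N` and `v ^ N`, the syzygies of `(g₀, g₁)` are
trivial. -/
theorem exists_eq_mul_of_syzygy {g₀ g₁ : PS2} {N : ℕ}
    (hN : ∀ i : Fin 2, (MvPowerSeries.X i : PS2) ^ N ∈ Ideal.span {g₀, g₁}) {x y : PS2}
    (hxy : g₀ * x = g₁ * y) : ∃ c, x = c * g₁ ∧ y = c * g₀ := by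
  obtain ⟨a, b, hab⟩ := Ideal.mem_span_pair.1 (hN 0)
  obtain ⟨a', b', hab'⟩ := Ideal.mem_span_pair.1 (hN 1)
  set U : PS2 := MvPowerSeries.X 0 ^ N with hU
  set V : PS2 := MvPowerSeries.X 1 ^ N with hV
  have hU0 : U ≠ 0 := fun h => by
    simpa [hU, MvPowerSeries.X_pow_eq] using
      congrArg (MvPowerSeries.coeff (Finsupp.single (0 : Fin 2) N)) h
  -- The multiplier c is found as a fraction: it should be (ay + bx)/U and also (a'y + b'x)/V. The
  -- two agree because g₀ and g₁ are not both zero, and coprimality of U and V clears the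
  -- denominator.
  have e₁ : U * x = (a * y + b * x) * g₁ := by linear_combination -x * hab + a * hxy
  have e₂ : U * y = (a * y + b * x) * g₀ := by linear_combination -y * hab - b * hxy
  have e₃ : V * x = (a' * y + b' * x) * g₁ := by linear_combination -x * hab' + a' * hxy
  have e₄ : V * y = (a' * y + b' * x) * g₀ := by linear_combination -y * hab' - b' * hxy
  have hc : (a * y + b * x) * V = (a' * y + b' * x) * U := by
    have k₁ : ((a * y + b * x) * V - (a' * y + b' * x) * U) * g₁ = 0 := by
      linear_combination -V * e₁ + U * e₃
    have k₂ : ((a * y + b * x) * V - (a' * y + b' * x) * U) * g₀ = 0 := by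
      linear_combination -V * e₂ + U * e₄
    rcases mul_eq_zero.1 k₁ with h | h
    · exact sub_eq_zero.1 h
    rcases mul_eq_zero.1 k₂ with h' | h'
    · exact sub_eq_zero.1 h'
    · exact absurd (by rw [← hab, h, h']; ring) hU0
  obtain ⟨c, hc'⟩ := X_pow_dvd_of_dvd_mul (Dvd.intro_left _ hc.symm)
  refine ⟨c, mul_left_cancel₀ hU0 ?_, mul_left_cancel₀ hU0 ?_⟩
  · rw [e₁, hc']; ring
  · rw [e₂, hc']; ring

/-! ### Weight decomposition of the Milnor algebra -/

theorem monomial_mem_weightPiece (w : Fin 2 → ℚ) (m : Fin 2 →₀ ℕ) (x : ℂ) :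
    MvPowerSeries.monomial m x ∈ weightPiece w (m 0 * w 0 + m 1 * w 1) := by
  intro a ha
  by_cases h : a = m
  · rw [h]
  · exact absurd (MvPowerSeries.coeff_monomial_ne h x) ha

/-- The monomials `u ^ i v ^ j` with `i, j < N`. -/
def box (N : ℕ) : Finset (Fin 2 →₀ ℕ) := Finset.Iic (Finsupp.equivFunOnFinite.symm fun _ => N)

theorem mem_box {N : ℕ} {m : Fin 2 →₀ ℕ} : m ∈ box N ↔ m 0 ≤ N ∧ m 1 ≤ N := by
  simp [box, Finsupp.le_def, Fin.forall_fin_two]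

/-- A monomial outside the box is divisible by u^N or v^N, so the tail splits into a multiple of
each. The box also includes exponents equal to N, which is harmless. -/
theorem sub_sum_monomial_mem {I : Ideal PS2} {N : ℕ}
    (hN : ∀ i : Fin 2, (MvPowerSeries.X i : PS2) ^ N ∈ I) (h : PS2) :
    h - ∑ m ∈ box N, MvPowerSeries.monomial m (MvPowerSeries.coeff m h) ∈ I := by
  classical
  set r := h - ∑ m ∈ box N, MvPowerSeries.monomial m (MvPowerSeries.coeff m h) with hr
  have hr0 (m) (hm : m ∈ box N) : MvPowerSeries.coeff m r = 0 := by
    simp [hr, MvPowerSeries.coeff_monomial, hm]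
  -- The part of the tail divisible by u^N; what remains has small u-exponent, hence is divisible by
  -- v^N.
  let s : PS2 := fun m => if m 0 < N then 0 else MvPowerSeries.coeff m r
  have hs (m) : MvPowerSeries.coeff m s = if m 0 < N then 0 else MvPowerSeries.coeff m r := rfl
  rw [← sub_add_cancel r s]
  refine I.add_mem (I.mem_of_dvd ?_ (hN 1)) (I.mem_of_dvd ?_ (hN 0))
  · rw [MvPowerSeries.X_pow_dvd_iff]
    intro m hm
    rw [map_sub, hs]
    split_ifs with h0
    · rw [hr0 m (mem_box.2 ⟨h0.le, hm.le⟩), sub_zero]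
    · rw [sub_self]
  · rw [MvPowerSeries.X_pow_dvd_iff]
    intro m hm
    rw [hs, if_pos hm]

theorem iSup_milnorPiece {f : PS2} {N : ℕ}
    (hN : ∀ i : Fin 2, (MvPowerSeries.X i : PS2) ^ N ∈ jacobianIdeal f) (w : Fin 2 → ℚ) :
    ⨆ c : ℚ, milnorPiece f w c = ⊤ := by
  rw [eq_top_iff]
  intro x _
  obtain ⟨h, rfl⟩ := Ideal.Quotient.mk_surjective x
  rw [Ideal.Quotient.eq.2 (sub_sum_monomial_mem hN h), map_sum]
  refine sum_mem fun m _ => ?_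
  exact Submodule.mem_iSup_of_mem _
    (Submodule.mem_map_of_mem (monomial_mem_weightPiece w m _))

theorem milnorPiece_eq_bot (f : PS2) {w : Fin 2 → ℚ} (hw : ∀ i, 0 ≤ w i) {c : ℚ} (hc : c < 0) :
    milnorPiece f w c = ⊥ := by
  have h0 : weightPiece w c = ⊥ := by
    rw [eq_bot_iff]
    intro h hh
    refine (Submodule.mem_bot ℂ).2 (MvPowerSeries.ext fun m => ?_)
    by_contra h1
    have h2 := hh m h1
    have h3 := mul_nonneg (Nat.cast_nonneg (α := ℚ) (m 0)) (hw 0)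
    have h4 := mul_nonneg (Nat.cast_nonneg (α := ℚ) (m 1)) (hw 1)
    linarith
  rw [milnorPiece, h0, Submodule.map_bot]

/-- The operator on the Milnor algebra induced by `euler a b + s`. -/
def milnorEuler {a b : ℂ} {f : PS2} (hf : euler a b f = f) (s : ℂ) :
    Milnor f →ₗ[ℂ] Milnor f :=
  (Submodule.Quotient.restrictScalarsEquiv ℂ (jacobianIdeal f)).toLinearMap ∘ₗ
    ((jacobianIdeal f).restrictScalars ℂ).mapQ ((jacobianIdeal f).restrictScalars ℂ)
      (euler a b + s • LinearMap.id) (fun h hh => by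
        change euler a b h + s • h ∈ (jacobianIdeal f).restrictScalars ℂ
        exact add_mem (euler_mem_jacobianIdeal hf hh) (Submodule.smul_mem _ s hh)) ∘ₗ
    (Submodule.Quotient.restrictScalarsEquiv ℂ (jacobianIdeal f)).symm.toLinearMap

theorem milnorEuler_toMilnor {a b : ℂ} {f : PS2} (hf : euler a b f = f) (s : ℂ) (h : PS2) :
    milnorEuler hf s (toMilnor f h) = toMilnor f (euler a b h + s • h) := rfl

theorem milnorEuler_of_mem {w₁ w₂ : ℚ} {f : PS2} (hf : euler w₁ w₂ f = f) (s : ℂ) {c : ℚ}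
    {m : Milnor f} (hm : m ∈ milnorPiece f ![w₁, w₂] c) :
    milnorEuler hf s m = ((c : ℂ) + s) • m := by
  obtain ⟨h, hh, rfl⟩ := hm
  have h1 : euler w₁ w₂ h = (c : ℂ) • h := IsWeightedHomogeneous.euler_eq hh
  change milnorEuler hf s (toMilnor f h) = _
  rw [milnorEuler_toMilnor, h1, ← add_smul]
  rfl

theorem milnorPiece_le_eigenspace {w₁ w₂ : ℚ} {f : PS2} (hf : euler w₁ w₂ f = f) (s : ℂ) (c : ℚ) :
    milnorPiece f ![w₁, w₂] c ≤ Module.End.eigenspace (milnorEuler hf s) ((c : ℂ) + s) :=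
  fun _ hm => Module.End.mem_eigenspace_iff.2 (milnorEuler_of_mem hf s hm)

theorem iSupIndep_milnorPiece {w₁ w₂ : ℚ} {f : PS2} (hf : euler w₁ w₂ f = f) :
    iSupIndep fun c : ℚ => milnorPiece f ![w₁, w₂] c := by
  have h := (Module.End.eigenspaces_iSupIndep (milnorEuler hf 0)).comp
    (f := fun c : ℚ => (c : ℂ) + 0) (fun x y hxy => by simpa using hxy)
  exact h.mono fun c => milnorPiece_le_eigenspace hf 0 c

theorem milnorEuler_bijective {w₁ w₂ : ℚ} {f : PS2} (hf : euler w₁ w₂ f = f)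
    (hw₁ : 0 ≤ w₁) (hw₂ : 0 ≤ w₂) (htop : ⨆ c : ℚ, milnorPiece f ![w₁, w₂] c = ⊤)
    {s : ℚ} (hs : 0 < s) : Function.Bijective (milnorEuler hf (s : ℂ)) := by
  have hbot (c : ℚ) (hc : c < 0) : milnorPiece f ![w₁, w₂] c = ⊥ :=
    milnorPiece_eq_bot f (by simp [Fin.forall_fin_two, hw₁, hw₂]) hc
  have hne (c : ℚ) (hc : 0 ≤ c) : (c : ℂ) + s ≠ 0 := by
    have : c + s ≠ 0 := by positivity
    exact_mod_cast this
  constructor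
  · rw [← LinearMap.ker_eq_bot]
    -- The kernel is the eigenspace for 0. It is independent of the eigenspaces for c + s ≠ 0, which
    -- already span everything.
    have h := (Module.End.eigenspaces_iSupIndep (milnorEuler hf (s : ℂ))) 0
    rw [Module.End.eigenspace_zero] at h
    refine disjoint_top.1 (h.mono_right ?_)
    rw [← htop, iSup_le_iff]
    intro c
    rcases lt_or_ge c 0 with hc | hc
    · rw [hbot c hc]
      exact bot_le
    · exact (milnorPiece_le_eigenspace hf s c).trans
        (le_iSup₂_of_le _ (hne c hc) le_rfl)
  · rw [← LinearMap.range_eq_top, eq_top_iff, ← htop, iSup_le_iff]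
    intro c
    rcases lt_or_ge c 0 with hc | hc
    · rw [hbot c hc]
      exact bot_le
    · intro m hm
      refine ⟨((c : ℂ) + s)⁻¹ • m, ?_⟩
      rw [map_smul, milnorEuler_of_mem hf s hm, smul_smul, inv_mul_cancel₀ (hne c hc), one_smul]

end PS2

namespace KoszulDeRham

/-! ### The kernel of the reduction is acyclic -/

/-- The Clifford relation for ε: the two summands are the ε-free part of a form and its part
divisible by ε. -/
theorem contract_wedge_two (ω : Form) : contract 2 (wedge 2 ω) + wedge 2 (contract 2 ω) = ω := by
  have hs (I : Finset (Fin 3)) : sgn 2 I * sgn 2 I = 1 := by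
    rw [sgn, ← mul_pow]; simp
  have hi (I : Finset (Fin 3)) : sgn 2 (insert 2 I) = sgn 2 I := by simp [sgn_two]
  have he (I : Finset (Fin 3)) : sgn 2 (I.erase 2) = sgn 2 I := by simp [sgn_two]
  funext I m
  by_cases h2 : 2 ∈ I
  · simp [wedge, contract, h2, he, ← mul_assoc, hs]
  · simp [wedge, contract, h2, hi, ← mul_assoc, hs]

theorem wedge_zero_wedge_two (ω : Form) : wedge 0 (wedge 2 ω) = -wedge 2 (wedge 0 ω) := by
  funext I m
  by_cases h0 : 0 ∈ I <;> by_cases h1 : 1 ∈ I <;> by_cases h2 : 2 ∈ I <;>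
    simp [wedge, sgn_zero, sgn_two, h0, h1, h2, Finset.erase_right_comm]

theorem wedge_one_wedge_two (ω : Form) : wedge 1 (wedge 2 ω) = -wedge 2 (wedge 1 ω) := by
  funext I m
  by_cases h0 : 0 ∈ I <;> by_cases h1 : 1 ∈ I <;> by_cases h2 : 2 ∈ I <;>
    simp [wedge, sgn_one, sgn_two, h0, h1, h2, Finset.erase_right_comm]

/-- The operator `df ∂/∂(dε)`. -/
def dfDeriv (f : PS2) : Form →ₗ[PS2] Form :=
  partialD 0 f • (wedge 0 ∘ₗ derivDeps) + partialD 1 f • (wedge 1 ∘ₗ derivDeps)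

theorem dfDeriv_apply (f : PS2) (ω : Form) : dfDeriv f ω =
    partialD 0 f • wedge 0 (derivDeps ω) + partialD 1 f • wedge 1 (derivDeps ω) := rfl

theorem del_eq_sub_dfDeriv (f : PS2) (ω : Form) : del f ω = f • contract 2 ω - dfDeriv f ω := rfl

theorem dfDeriv_wedge_two (f : PS2) (ω : Form) :
    dfDeriv f (wedge 2 ω) = -wedge 2 (dfDeriv f ω) := by
  simp only [dfDeriv_apply, ← wedge_derivDeps, wedge_zero_wedge_two, wedge_one_wedge_two, map_add,
    map_smul, smul_neg]
  abel

theorem contract_dfDeriv (f : PS2) (ω : Form) :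
    contract 2 (dfDeriv f ω) = -dfDeriv f (contract 2 ω) := by
  simp only [dfDeriv_apply, ← contract_derivDeps, contract_wedge_zero, contract_wedge_one, map_add,
    map_smul, smul_neg]
  abel

theorem wedge_two_piece {α : Form} {q : ℕ} {n : ℤ} (h : α ∈ piece q n) :
    (∀ I m, 2 ∈ I → α I m = 0) → wedge 2 α ∈ piece q (n - 1) := by
  intro h0 I m hI
  by_cases h2 : 2 ∈ I
  · obtain ⟨h3, h4⟩ := h (I.erase 2) m fun h0 => hI (by simp [wedge, h2, h0])
    simp [formDeg, cohDeg, h2] at h3 h4 ⊢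
    omega
  · simp [wedge, h2] at hI

theorem wedge_two_mem_dgIdeal (f : PS2) (α : Form) : wedge 2 α ∈ dgIdeal f := by
  intro I hI m
  simp [wedge, hI]

/-- An element of the dg ideal is x = fα + εβ with α, β free of ε. With D = df ∂/∂(dε), one has
∂(εα) = fα + εDα, so the primitive εα works as soon as β = Dα, and the cocycle condition forces
this. -/
theorem exists_del_eq_of_mem_dgIdeal {f : PS2} (hf : f ≠ 0) {q : ℕ} {n : ℤ} {x : Form}
    (hx : x ∈ piece q n) (hK : x ∈ dgIdeal f) (h : del f x = 0) :
    ∃ y ∈ piece q (n - 1), y ∈ dgIdeal f ∧ del f y = x := by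
  have hα : ∀ I m, ∃ r : PS2, (2 ∈ I → r = 0) ∧ (2 ∉ I → x I m = f * r) := by
    intro I m
    by_cases h2 : 2 ∈ I
    · exact ⟨0, by simp [h2]⟩
    · obtain ⟨r, hr⟩ := hK I h2 m
      exact ⟨r, by simp [h2, hr]⟩
  choose α hα₀ hα₁ using hα
  have hαp : α ∈ piece q n := by
    intro I m hI
    have h2 : 2 ∉ I := fun h2 => hI (hα₀ I m h2)
    exact hx I m (by rw [hα₁ I m h2]; exact mul_ne_zero hf hI)
  have hcα : contract 2 α = 0 := by
    funext I m
    by_cases h2 : 2 ∈ I <;> simp [contract, h2, hα₀ (insert 2 I) m]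
  have hwα : contract 2 (wedge 2 α) = α := by
    simpa [hcα] using contract_wedge_two α
  set β := contract 2 x with hβ
  have hcβ : contract 2 β = 0 := contract_self 2 x
  have hxαβ : x = f • α + wedge 2 β := by
    have h1 : contract 2 (wedge 2 x) = f • α := by
      funext I m
      have hs : sgn 2 I * sgn 2 I = 1 := by rw [sgn, ← mul_pow]; simp
      have hi : sgn 2 (insert 2 I) = sgn 2 I := by simp [sgn_two]
      by_cases h2 : 2 ∈ I
      · simp [contract, h2, hα₀ I m]
      · simp [contract, wedge, h2, hα₁ I m, hi, ← mul_assoc, hs]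
    rw [← h1, contract_wedge_two]
  -- The left side is free of ε and the right side is a multiple of ε, so both vanish; f is then
  -- cancelled.
  have hz : f • (β - dfDeriv f α) = -wedge 2 (dfDeriv f β) := by
    rw [del_eq_sub_dfDeriv, ← hβ] at h
    have h1 : dfDeriv f x = f • dfDeriv f α - wedge 2 (dfDeriv f β) := by
      conv_lhs => rw [hxαβ]
      rw [map_add, map_smul, dfDeriv_wedge_two, sub_eq_add_neg]
    rw [h1] at h
    rw [smul_sub, ← sub_eq_zero, ← h]
    abel
  have hDβ : dfDeriv f β = 0 := by
    have h1 := congrArg (contract 2) hz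
    have h2 := contract_wedge_two (dfDeriv f β)
    simp only [map_smul, map_sub, map_neg, contract_dfDeriv, hcβ, hcα, map_zero, neg_zero, sub_zero,
      smul_zero, add_zero] at h1 h2
    rw [← h2]
    exact neg_eq_zero.1 h1.symm
  have hβα : β = dfDeriv f α := by
    rw [hDβ, map_zero, neg_zero] at hz
    exact sub_eq_zero.1 ((smul_eq_zero.1 hz).resolve_left hf)
  refine ⟨wedge 2 α, wedge_two_piece hαp hα₀, wedge_two_mem_dgIdeal f α, ?_⟩
  rw [del_eq_sub_dfDeriv, hwα, dfDeriv_wedge_two, sub_neg_eq_add, ← hβα, ← hxαβ]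

/-! ### Representatives of classes and the quasi-isomorphism -/

theorem delA_mkQ (f : PS2) (ω : Form) :
    delA f ((dgIdeal f).mkQ ω) = (dgIdeal f).mkQ (del f ω) := rfl

theorem mkQ_eq_iff {f : PS2} {ω ω' : Form} :
    (dgIdeal f).mkQ ω = (dgIdeal f).mkQ ω' ↔ ω - ω' ∈ dgIdeal f :=
  Submodule.Quotient.eq _

/-- The class of a cocycle in `H^n(Ω^q_S)`. -/
def mkHForm (f : PS2) (q : ℕ) (n : ℤ) (ω : Form) (h₁ : ω ∈ piece q n) (h₂ : del f ω = 0) :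
    HForm f q n :=
  (coboundaries (del f) (piece q) n).mkQ ⟨ω, h₁, h₂⟩

theorem represents_red {f : PS2} {q : ℕ} {n : ℤ} {ω : Form} (h₁ : ω ∈ piece q n)
    (h₂ : del f ω = 0) : Represents f q n ω (red f q n (mkHForm f q n ω h₁ h₂)) :=
  ⟨⟨(dgIdeal f).mkQ ω, Submodule.mem_map_of_mem h₁, by simp [delA, h₂]⟩, rfl, rfl⟩

theorem Represents.eq_iff {f : PS2} {q : ℕ} {n : ℤ} {ω ω' : Form} {x y : HExt f q n}
    (hx : Represents f q n ω x) (hy : Represents f q n ω' y) :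
    x = y ↔ ∃ ξ ∈ piece q (n - 1), ω - ω' - del f ξ ∈ dgIdeal f := by
  obtain ⟨z, hz, rfl⟩ := hx
  obtain ⟨z', hz', rfl⟩ := hy
  rw [Submodule.mkQ_apply, Submodule.mkQ_apply, Submodule.Quotient.eq]
  constructor
  · rintro ⟨_, ⟨ξ, hξ, rfl⟩, h⟩
    refine ⟨ξ, hξ, ?_⟩
    rw [← mkQ_eq_iff, map_sub, ← hz, ← hz']
    exact h.symm
  · rintro ⟨ξ, hξ, h⟩
    refine ⟨(dgIdeal f).mkQ ξ, Submodule.mem_map_of_mem hξ, ?_⟩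
    rw [← mkQ_eq_iff, map_sub, ← hz, ← hz'] at h
    exact h.symm

theorem Represents.congr {f : PS2} {q : ℕ} {n : ℤ} {ω ω' : Form} {x : HExt f q n}
    (hx : Represents f q n ω x) (h : ω - ω' ∈ dgIdeal f) : Represents f q n ω' x := by
  obtain ⟨z, hz, rfl⟩ := hx
  exact ⟨z, by rw [hz, mkQ_eq_iff]; exact h, rfl⟩

theorem Represents.del_mem {f : PS2} {q : ℕ} {n : ℤ} {ω : Form} {x : HExt f q n}
    (hx : Represents f q n ω x) : del f ω ∈ dgIdeal f := by
  obtain ⟨⟨z, hz₁, hz₂⟩, hz, -⟩ := hx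
  have h : delA f z = 0 := hz₂
  change z = _ at hz
  rw [hz, delA_mkQ] at h
  exact (Submodule.Quotient.mk_eq_zero _).1 h

theorem exists_represents {f : PS2} {q : ℕ} {n : ℤ} (x : HExt f q n) :
    ∃ ω ∈ piece q n, Represents f q n ω x := by
  obtain ⟨z, rfl⟩ := Submodule.mkQ_surjective _ x
  obtain ⟨ω, hω, h⟩ := z.2.1
  exact ⟨ω, hω, z, h.symm, rfl⟩

theorem represents_zero (f : PS2) (q : ℕ) (n : ℤ) : Represents f q n 0 0 :=
  ⟨0, (map_zero _).symm, map_zero _⟩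

theorem red_bijective {f : PS2} (hf : f ≠ 0) (q : ℕ) (n : ℤ) :
    Function.Bijective (red f q n) := by
  constructor
  · rw [injective_iff_map_eq_zero]
    intro x hx
    obtain ⟨⟨ω, h₁, h₂⟩, rfl⟩ := Submodule.mkQ_surjective _ x
    obtain ⟨ξ, hξ, h⟩ := ((represents_red h₁ h₂).eq_iff (represents_zero f q n)).1 hx
    rw [sub_zero] at h
    have hp : ω - del f ξ ∈ piece q n :=
      sub_mem h₁ (by simpa using del_piece f hξ)
    have h₂' : del f ω = 0 := h₂
    obtain ⟨y, hy, -, hyx⟩ := exists_del_eq_of_mem_dgIdeal hf hp h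
      (by rw [map_sub, h₂', del_del, sub_zero])
    refine (Submodule.Quotient.mk_eq_zero _).2 ⟨y + ξ, add_mem hy hξ, ?_⟩
    rw [map_add, hyx, sub_add_cancel]
    rfl
  · intro x
    obtain ⟨ω, hω, h⟩ := exists_represents x
    -- ∂ω is a cocycle in the acyclic ideal. Subtracting a primitive inside the ideal turns ω into a
    -- true cocycle with the same reduction.
    obtain ⟨y, hy, hyK, hyx⟩ :=
      exists_del_eq_of_mem_dgIdeal hf (del_piece f hω) h.del_mem (del_del f ω)
    rw [add_sub_cancel_right] at hy
    have h₂ : del f (ω - y) = 0 := by rw [map_sub, hyx, sub_self]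
    refine ⟨mkHForm f q n (ω - y) (sub_mem hω hy) h₂,
      ((represents_red _ h₂).eq_iff h).2 ⟨0, zero_mem _, ?_⟩⟩
    rw [map_zero, sub_zero, sub_sub_cancel_left]
    exact neg_mem hyK

/-! ### The basis forms -/

theorem mono_apply (I J : Finset (Fin 3)) (m k : ℕ) (r : PS2) :
    mono I m r J k = if J = I ∧ k = m then r else 0 := by
  by_cases h : J = I
  · subst h
    by_cases hk : k = m <;> simp [mono, hk]
  · simp [mono, h]

theorem mono_mem_piece (I : Finset (Fin 3)) (m : ℕ) (r : PS2) :
    mono I m r ∈ piece (formDeg I m) (cohDeg I m) := by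
  intro J k h
  rw [mono_apply] at h
  split_ifs at h with h'
  · rw [h'.1, h'.2]
    exact ⟨rfl, rfl⟩
  · exact absurd rfl h

theorem mono_add (I : Finset (Fin 3)) (m : ℕ) (r s : PS2) :
    mono I m (r + s) = mono I m r + mono I m s := by
  simp [mono, Pi.single_add]

theorem mono_neg (I : Finset (Fin 3)) (m : ℕ) (r : PS2) : mono I m (-r) = -mono I m r := by
  simp [mono, Pi.single_neg]

theorem mono_zero (I : Finset (Fin 3)) (m : ℕ) : mono I m 0 = 0 := by
  simp [mono]

theorem smul_mono (I : Finset (Fin 3)) (m : ℕ) (r s : PS2) : s • mono I m r = mono I m (s * r) := by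
  simp [mono, ← Pi.single_smul]

theorem derivDeps_mono_succ (I : Finset (Fin 3)) (m : ℕ) (r : PS2) :
    derivDeps (mono I (m + 1) r) = mono I m r := by
  funext J k
  simp [derivDeps, mono_apply]

theorem mulDeps_mono (I : Finset (Fin 3)) (m : ℕ) (r : PS2) :
    mulDeps (mono I m r) = mono I (m + 1) ((m + 1 : PS2) * r) := by
  funext J k
  rcases k with _ | k
  · simp [mulDeps, mono_apply]
  · by_cases h : J = I ∧ k = m
    · simp [mulDeps, mono_apply, h]
    · simp [mulDeps, mono_apply, h]

theorem coeffD_mono (i : Fin 2) (I : Finset (Fin 3)) (m : ℕ) (r : PS2) :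
    coeffD i (mono I m r) = mono I m (partialD i r) := by
  funext J k
  by_cases h : J = I ∧ k = m
  · simp [coeffD, mono_apply, h]
  · simp [coeffD, mono_apply, h]

theorem wedge_mono_of_mem {j : Fin 3} {I : Finset (Fin 3)} (hj : j ∈ I) (m : ℕ) (r : PS2) :
    wedge j (mono I m r) = 0 := by
  funext J k
  by_cases h : j ∈ J
  · have h1 : J.erase j ≠ I := fun h1 => by simp [← h1] at hj
    simp [wedge, mono_apply, h, h1]
  · simp [wedge, h]

theorem wedge_mono {j : Fin 3} {I : Finset (Fin 3)} (hj : j ∉ I) (m : ℕ) (r : PS2) :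
    wedge j (mono I m r) = mono (insert j I) m (sgn j (insert j I) * r) := by
  funext J k
  by_cases h : j ∈ J
  · have h1 : J.erase j = I ↔ J = insert j I := by
      rw [Finset.erase_eq_iff_eq_insert h hj]
    by_cases h2 : J = insert j I ∧ k = m
    · simp [wedge, mono_apply, h2, hj]
    · simp [wedge, mono_apply, h, h1, h2]
  · have h1 : J ≠ insert j I := fun h1 => h (by simp [h1])
    simp [wedge, mono_apply, h, h1]

theorem contract_mono_of_notMem {j : Fin 3} {I : Finset (Fin 3)} (hj : j ∉ I) (m : ℕ) (r : PS2) :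
    contract j (mono I m r) = 0 := by
  funext J k
  have h1 : insert j J ≠ I := fun h1 => hj (by simp [← h1])
  simp [contract, mono_apply, h1]

theorem contract_mono {j : Fin 3} {I : Finset (Fin 3)} (hj : j ∈ I) (m : ℕ) (r : PS2) :
    contract j (mono I m r) = mono (I.erase j) m (sgn j (I.erase j) * r) := by
  funext J k
  by_cases h : j ∈ J
  · have h1 : J ≠ I.erase j := fun h1 => by simp [h1] at h
    simp [contract, mono_apply, h, h1]
  · have h1 : insert j J = I ↔ J = I.erase j := by
      rw [eq_comm, eq_comm (a := J), Finset.erase_eq_iff_eq_insert hj h]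
    by_cases h2 : J = I.erase j ∧ k = m
    · simp [contract, mono_apply, h2, Finset.insert_erase hj]
    · simp [contract, mono_apply, h, h1, h2]

theorem wedge_zero_mono_empty (m : ℕ) (r : PS2) : wedge 0 (mono ∅ m r) = mono {0} m r := by
  simpa [sgn_zero] using wedge_mono (j := 0) (I := ∅) (by decide) m r

theorem wedge_one_mono_empty (m : ℕ) (r : PS2) : wedge 1 (mono ∅ m r) = mono {1} m r := by
  simpa [sgn_one] using wedge_mono (j := 1) (I := ∅) (by decide) m r

theorem wedge_zero_mono_one (m : ℕ) (r : PS2) : wedge 0 (mono {1} m r) = mono {0, 1} m r := by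
  simpa [sgn_zero] using wedge_mono (j := 0) (I := {1}) (by decide) m r

theorem wedge_one_mono_zero (m : ℕ) (r : PS2) : wedge 1 (mono {0} m r) = -mono {0, 1} m r := by
  rw [wedge_mono (by decide), show (insert 1 {0} : Finset (Fin 3)) = {0, 1} by decide, ← mono_neg]
  simp [sgn_one]

theorem del_mono_empty (f c : PS2) (m : ℕ) :
    del f (mono ∅ (m + 1) c) = -oneForm (partialD 0 f * c) (partialD 1 f * c) m := by
  rw [del_apply, contract_mono_of_notMem (by decide), derivDeps_mono_succ, wedge_zero_mono_empty,
    wedge_one_mono_empty, smul_mono, smul_mono, smul_zero, zero_sub]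
  rfl

theorem del_oneForm (f a b : PS2) (m : ℕ) :
    del f (oneForm a b (m + 1)) = -twoForm (partialD 0 f * b - partialD 1 f * a) m := by
  simp only [del_apply, oneForm, map_add, derivDeps_mono_succ, wedge_zero_mono_one,
    wedge_one_mono_zero, contract_mono_of_notMem (show (2 : Fin 3) ∉ ({0} : Finset _) by decide),
    contract_mono_of_notMem (show (2 : Fin 3) ∉ ({1} : Finset _) by decide),
    wedge_mono_of_mem (show (0 : Fin 3) ∈ ({0} : Finset _) by decide),
    wedge_mono_of_mem (show (1 : Fin 3) ∈ ({1} : Finset _) by decide), smul_neg,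
    smul_mono, twoForm, sub_eq_add_neg, mono_add, mono_neg, smul_zero]
  abel

theorem del_twoForm (f h : PS2) (m : ℕ) : del f (twoForm h m) = 0 := by
  simp [del_apply, twoForm, wedge_derivDeps,
    contract_mono_of_notMem (show (2 : Fin 3) ∉ ({0, 1} : Finset _) by decide),
    wedge_mono_of_mem (show (0 : Fin 3) ∈ ({0, 1} : Finset _) by decide),
    wedge_mono_of_mem (show (1 : Fin 3) ∈ ({0, 1} : Finset _) by decide)]

theorem contract_mono_top (h : PS2) (m : ℕ) : contract 2 (mono {0, 1, 2} m h) = twoForm h m := by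
  rw [contract_mono (by decide), show ({0, 1, 2} : Finset (Fin 3)).erase 2 = {0, 1} by decide,
    twoForm]
  simp [sgn_two]

theorem del_mono_top (f h : PS2) (m : ℕ) : del f (mono {0, 1, 2} m h) = twoForm (f * h) m := by
  rw [del_apply, contract_mono_top, wedge_derivDeps, wedge_derivDeps,
    wedge_mono_of_mem (by decide), wedge_mono_of_mem (by decide), twoForm, smul_mono]
  simp [twoForm]

theorem dR_oneForm (a b : PS2) (m : ℕ) :
    dR (oneForm a b m) = twoForm (partialD 0 b - partialD 1 a) m := by
  simp only [dR_apply, oneForm, map_add, coeffD_mono, wedge_zero_mono_one,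
    wedge_one_mono_zero, contract_mono_of_notMem (show (2 : Fin 3) ∉ ({0} : Finset _) by decide),
    contract_mono_of_notMem (show (2 : Fin 3) ∉ ({1} : Finset _) by decide),
    wedge_mono_of_mem (show (0 : Fin 3) ∈ ({0} : Finset _) by decide),
    wedge_mono_of_mem (show (1 : Fin 3) ∈ ({1} : Finset _) by decide),
    twoForm, sub_eq_add_neg, mono_add, mono_neg, map_zero]
  abel

theorem dR_mono_top (h : PS2) (m : ℕ) :
    dR (mono {0, 1, 2} m h) = twoForm ((m + 1 : PS2) * h) (m + 1) := by
  rw [dR_apply, contract_mono_top, coeffD_mono, coeffD_mono, wedge_mono_of_mem (by decide),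
    wedge_mono_of_mem (by decide), twoForm, mulDeps_mono, twoForm, add_zero, add_zero]

theorem oneForm_mem_piece (a b : PS2) (m : ℕ) : oneForm a b m ∈ piece (m + 1) (-m) := by
  refine add_mem ?_ ?_
  · convert mono_mem_piece {0} m a using 2
    · rw [formDeg, add_comm]; rfl
    · simp [cohDeg]
  · convert mono_mem_piece {1} m b using 2
    · rw [formDeg, add_comm]; rfl
    · simp [cohDeg]

theorem twoForm_mem_piece (h : PS2) (m : ℕ) : twoForm h m ∈ piece (m + 2) (-m) := by
  rw [twoForm]
  convert mono_mem_piece {0, 1} m h using 2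
  · rw [formDeg, add_comm]; rfl
  · simp [cohDeg]

theorem mono_empty_mem_piece (h : PS2) (m : ℕ) : mono ∅ m h ∈ piece m (-m) := by
  convert mono_mem_piece ∅ m h using 2
  · simp [formDeg]
  · simp [cohDeg]

theorem mono_top_mem_piece (h : PS2) (m : ℕ) : mono {0, 1, 2} m h ∈ piece (m + 2) (-(m + 1)) := by
  convert mono_mem_piece {0, 1, 2} m h using 2
  · rw [formDeg, add_comm]; rfl
  · simp [cohDeg]; ring

theorem piece_apply_eq_zero {q m : ℕ} {ω : Form} (h : ω ∈ piece q (-m))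
    {I : Finset (Fin 3)} (hI : 2 ∉ I) {k : ℕ} (hk : k ≠ m ∨ I.card + m ≠ q) : ω I k = 0 := by
  by_contra h0
  obtain ⟨h1, h2⟩ := h I k h0
  simp [formDeg, cohDeg, hI] at h1 h2
  omega

/-- Among ε-free components the bidegree fixes both the power of dε and the number of factors du,
dv, so few coefficients need checking. -/
theorem mem_dgIdeal_of_piece {f : PS2} {q m : ℕ} {ω : Form} (h : ω ∈ piece q (-m))
    (h' : ∀ I, 2 ∉ I → I.card + m = q → ω I m = 0) : ω ∈ dgIdeal f := by
  intro I hI k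
  rw [show ω I k = 0 from ?_]
  · exact dvd_zero f
  · by_cases hk : k = m ∧ I.card + m = q
    · rw [hk.1]
      exact h' I hI hk.2
    · exact piece_apply_eq_zero h hI (by tauto)

theorem sub_mono_empty_mem_dgIdeal (f : PS2) {m : ℕ} {ω : Form} (h : ω ∈ piece m (-m)) :
    ω - mono ∅ m (ω ∅ m) ∈ dgIdeal f := by
  refine mem_dgIdeal_of_piece (sub_mem h (mono_empty_mem_piece _ m)) fun I _ hc => ?_
  obtain rfl : I = ∅ := Finset.card_eq_zero.1 (by omega)
  simp [mono_apply]

theorem oneForm_apply_zero (a b : PS2) (m : ℕ) : oneForm a b m {0} m = a := by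
  simp [oneForm, mono_apply, show ({0} : Finset (Fin 3)) ≠ {1} by decide]

theorem oneForm_apply_one (a b : PS2) (m : ℕ) : oneForm a b m {1} m = b := by
  simp [oneForm, mono_apply, show ({1} : Finset (Fin 3)) ≠ {0} by decide]

theorem twoForm_apply (h : PS2) (m : ℕ) : twoForm h m {0, 1} m = h := by
  simp [twoForm, mono_apply]

theorem eq_of_card_one : ∀ I : Finset (Fin 3), 2 ∉ I → I.card = 1 → I = {0} ∨ I = {1} := by
  decide

theorem eq_of_card_two : ∀ I : Finset (Fin 3), 2 ∉ I → I.card = 2 → I = {0, 1} := by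
  decide

theorem sub_oneForm_mem_dgIdeal (f : PS2) {m : ℕ} {ω : Form} (h : ω ∈ piece (m + 1) (-m)) :
    ω - oneForm (ω {0} m) (ω {1} m) m ∈ dgIdeal f := by
  refine mem_dgIdeal_of_piece (sub_mem h (oneForm_mem_piece _ _ m)) fun I hI hc => ?_
  rcases eq_of_card_one I hI (by omega) with rfl | rfl
  · simp [oneForm_apply_zero]
  · simp [oneForm_apply_one]

theorem sub_twoForm_mem_dgIdeal (f : PS2) {m : ℕ} {ω : Form} (h : ω ∈ piece (m + 2) (-m)) :
    ω - twoForm (ω {0, 1} m) m ∈ dgIdeal f := by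
  refine mem_dgIdeal_of_piece (sub_mem h (twoForm_mem_piece _ m)) fun I hI hc => ?_
  obtain rfl := eq_of_card_two I hI (by omega)
  simp [twoForm_apply]

theorem mono_mem_dgIdeal {f r : PS2} (h : f ∣ r) (I : Finset (Fin 3)) (m : ℕ) :
    mono I m r ∈ dgIdeal f := by
  intro J _ k
  rw [mono_apply]
  split_ifs
  · exact h
  · exact dvd_zero f

theorem oneForm_mem_dgIdeal {f a b : PS2} {m : ℕ} :
    oneForm a b m ∈ dgIdeal f ↔ f ∣ a ∧ f ∣ b := by
  constructor
  · intro h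
    have h0 := h {0} (by decide) m
    have h1 := h {1} (by decide) m
    rw [oneForm_apply_zero] at h0
    rw [oneForm_apply_one] at h1
    exact ⟨h0, h1⟩
  · rintro ⟨ha, hb⟩
    exact add_mem (mono_mem_dgIdeal ha _ _) (mono_mem_dgIdeal hb _ _)

theorem twoForm_mem_dgIdeal {f h : PS2} {m : ℕ} : twoForm h m ∈ dgIdeal f ↔ f ∣ h := by
  constructor
  · intro h0
    have h1 := h0 {0, 1} (by decide) m
    rwa [twoForm_apply] at h1
  · intro h0
    exact mono_mem_dgIdeal h0 _ _

theorem oneForm_add (a b a' b' : PS2) (m : ℕ) :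
    oneForm (a + a') (b + b') m = oneForm a b m + oneForm a' b' m := by
  simp only [oneForm, mono_add]
  abel

theorem oneForm_neg (a b : PS2) (m : ℕ) : oneForm (-a) (-b) m = -oneForm a b m := by
  simp only [oneForm, mono_neg]
  abel

theorem oneForm_sub (a b a' b' : PS2) (m : ℕ) :
    oneForm (a - a') (b - b') m = oneForm a b m - oneForm a' b' m := by
  simp only [sub_eq_add_neg, oneForm_add, oneForm_neg]

theorem twoForm_add (h h' : PS2) (m : ℕ) : twoForm (h + h') m = twoForm h m + twoForm h' m :=
  mono_add _ _ _ _

theorem twoForm_sub (h h' : PS2) (m : ℕ) : twoForm (h - h') m = twoForm h m - twoForm h' m := by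
  simp only [twoForm, sub_eq_add_neg, mono_add, mono_neg]

/-! ### Cohomology classes of one-forms and two-forms -/

theorem exists_represents_oneForm {f : PS2} {m : ℕ} (x : HExt f (m + 1) (-m)) :
    ∃ a b, Represents f (m + 1) (-m) (oneForm a b m) x := by
  obtain ⟨ω, hω, h⟩ := exists_represents x
  exact ⟨_, _, h.congr (sub_oneForm_mem_dgIdeal f hω)⟩

theorem exists_represents_twoForm {f : PS2} {m : ℕ} (x : HExt f (m + 2) (-m)) :
    ∃ h, Represents f (m + 2) (-m) (twoForm h m) x := by
  obtain ⟨ω, hω, h⟩ := exists_represents x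
  exact ⟨_, h.congr (sub_twoForm_mem_dgIdeal f hω)⟩

theorem Represents.oneForm_dvd {f a b : PS2} {q m : ℕ} {n : ℤ} {x : HExt f q n}
    (h : Represents f q n (oneForm a b (m + 1)) x) :
    f ∣ partialD 0 f * b - partialD 1 f * a := by
  have h1 := h.del_mem
  rw [del_oneForm] at h1
  exact twoForm_mem_dgIdeal.1 (neg_mem_iff.1 h1)

theorem del_sub_mem_dgIdeal {f : PS2} {ξ ξ' : Form} (h : ξ - ξ' ∈ dgIdeal f) :
    del f ξ - del f ξ' ∈ dgIdeal f := by
  rw [← map_sub]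
  exact del_dgIdeal f h

theorem Represents.oneForm_eq_iff {f a b a' b' : PS2} {m : ℕ} {x y : HExt f (m + 1) (-m)}
    (hx : Represents f (m + 1) (-m) (oneForm a b m) x)
    (hy : Represents f (m + 1) (-m) (oneForm a' b' m) y) :
    x = y ↔ ∃ c, f ∣ a - a' + partialD 0 f * c ∧ f ∣ b - b' + partialD 1 f * c := by
  have hn : (-m - 1 : ℤ) = -((m + 1 : ℕ) : ℤ) := by push_cast; ring
  have key (c : PS2) : oneForm a b m - oneForm a' b' m - del f (mono ∅ (m + 1) c) ∈ dgIdeal f ↔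
      f ∣ a - a' + partialD 0 f * c ∧ f ∣ b - b' + partialD 1 f * c := by
    rw [del_mono_empty, sub_neg_eq_add, ← oneForm_sub, ← oneForm_add, oneForm_mem_dgIdeal]
  rw [hx.eq_iff hy, hn]
  constructor
  · rintro ⟨ξ, hξ, h⟩
    refine ⟨ξ ∅ (m + 1), (key _).1 ?_⟩
    -- Components of ξ containing ε lie in the dg ideal, which ∂ preserves, so only the coefficient
    -- of γ_{m+1} matters.
    have h1 := add_mem h (del_sub_mem_dgIdeal (sub_mono_empty_mem_dgIdeal f hξ))
    rwa [sub_add_sub_cancel] at h1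
  · rintro ⟨c, hc⟩
    exact ⟨mono ∅ (m + 1) c, mono_empty_mem_piece c (m + 1), (key c).2 hc⟩

/-- Coboundaries contribute J, and working modulo f adds nothing since f ∈ J. -/
theorem Represents.twoForm_eq_iff {f h h' : PS2} (hf : f ∈ jacobianIdeal f) {m : ℕ}
    {x y : HExt f (m + 2) (-m)} (hx : Represents f (m + 2) (-m) (twoForm h m) x)
    (hy : Represents f (m + 2) (-m) (twoForm h' m) y) : x = y ↔ h - h' ∈ jacobianIdeal f := by
  have hn : (-m - 1 : ℤ) = -((m + 1 : ℕ) : ℤ) := by push_cast; ring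
  have key (a b : PS2) :
      twoForm h m - twoForm h' m - del f (oneForm a b (m + 1)) ∈ dgIdeal f ↔
        f ∣ h - h' + (partialD 0 f * b - partialD 1 f * a) := by
    rw [del_oneForm, sub_neg_eq_add, ← twoForm_sub, ← twoForm_add, twoForm_mem_dgIdeal]
  rw [hx.eq_iff hy, hn]
  constructor
  · rintro ⟨ξ, hξ, h0⟩
    have h1 := add_mem h0 (del_sub_mem_dgIdeal (sub_oneForm_mem_dgIdeal f hξ))
    rw [sub_add_sub_cancel, key] at h1
    obtain ⟨c, hc⟩ := h1
    rw [eq_sub_of_add_eq hc]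
    exact sub_mem (Ideal.mul_mem_right _ _ hf)
      (sub_mem (Ideal.mul_mem_right _ _ (partialD_mem_jacobianIdeal 0 f))
        (Ideal.mul_mem_right _ _ (partialD_mem_jacobianIdeal 1 f)))
  · intro h0
    obtain ⟨a, b, hab⟩ := mem_jacobianIdeal.1 h0
    refine ⟨oneForm b (-a) (m + 1), oneForm_mem_piece _ _ (m + 1), (key _ _).2 ?_⟩
    rw [← hab]
    exact ⟨0, by ring⟩

/-- The map to cohomology given by a linear family of cocycles. -/
def classMap (f : PS2) (q : ℕ) (n : ℤ) (φ : PS2 →ₗ[PS2] Form) (h₁ : ∀ h, φ h ∈ piece q n)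
    (h₂ : ∀ h, del f (φ h) ∈ dgIdeal f) : PS2 →ₗ[PS2] HExt f q n :=
  (coboundaries (delA f) (pieceA f q) n).mkQ ∘ₗ
    ((dgIdeal f).mkQ ∘ₗ φ).codRestrict (cocycles (delA f) (pieceA f q) n) fun h =>
      ⟨Submodule.mem_map_of_mem (h₁ h), (Submodule.Quotient.mk_eq_zero _).2 (h₂ h)⟩

theorem represents_classMap {f : PS2} {q : ℕ} {n : ℤ} {φ : PS2 →ₗ[PS2] Form}
    (h₁ : ∀ h, φ h ∈ piece q n) (h₂ : ∀ h, del f (φ h) ∈ dgIdeal f) (h : PS2) :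
    Represents f q n (φ h) (classMap f q n φ h₁ h₂ h) :=
  ⟨_, rfl, rfl⟩

end KoszulDeRham

/-! ### Identification of the cohomology with the Milnor algebra -/

namespace KoszulDeRham

theorem Represents.unique {f : PS2} {q : ℕ} {n : ℤ} {ω : Form} {x y : HExt f q n}
    (hx : Represents f q n ω x) (hy : Represents f q n ω y) : x = y :=
  (hx.eq_iff hy).2 ⟨0, zero_mem _, by simp⟩

/-- The linear family of one-forms `h (a u dv - b v du) γ_m`. -/
def eulerForm (a b : ℂ) (m : ℕ) : PS2 →ₗ[PS2] Form where
  toFun h := oneForm (-(b • (MvPowerSeries.X 1 * h))) (a • (MvPowerSeries.X 0 * h)) m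
  map_add' x y := by
    rw [← oneForm_add, mul_add, mul_add, smul_add, smul_add, neg_add]
  map_smul' r x := by
    rw [RingHom.id_apply, oneForm, oneForm, smul_add, smul_mono, smul_mono]
    simp only [smul_eq_mul, MvPowerSeries.smul_eq_C_mul]
    congr 2 <;> ring

theorem eulerForm_apply (a b : ℂ) (m : ℕ) (h : PS2) : eulerForm a b m h =
    oneForm (-(b • (MvPowerSeries.X 1 * h))) (a • (MvPowerSeries.X 0 * h)) m := rfl

/-- The linear family of two-forms `h du dv γ_m`. -/
def volumeForm (m : ℕ) : PS2 →ₗ[PS2] Form where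
  toFun h := twoForm h m
  map_add' x y := twoForm_add x y m
  map_smul' _ _ := (smul_mono _ _ _ _).symm

/-- This is df ∧ hα = h (Ef) du dv for the Euler form α = a u dv - b v du. -/
theorem euler_form_wedge {a b : ℂ} {f : PS2} (hf : euler a b f = f) (h : PS2) :
    partialD 0 f * (a • (MvPowerSeries.X 0 * h)) - partialD 1 f * -(b • (MvPowerSeries.X 1 * h))
      = f * h := by
  rw [euler_apply] at hf
  simp only [MvPowerSeries.smul_eq_C_mul] at hf ⊢
  linear_combination h * hf

theorem del_eulerForm {a b : ℂ} {f : PS2} (hf : euler a b f = f) (m : ℕ) (h : PS2) :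
    del f (eulerForm a b (m + 1) h) = -twoForm (f * h) m := by
  rw [eulerForm_apply, del_oneForm, euler_form_wedge hf]

theorem dR_eulerForm (a b : ℂ) (m : ℕ) (h : PS2) :
    dR (eulerForm a b m h) = twoForm (euler a b h + (a + b) • h) m := by
  have h0 : partialD 0 (MvPowerSeries.X 0 : PS2) = 1 := MvPowerSeries.pderiv_X_self
  have h1 : partialD 1 (MvPowerSeries.X 1 : PS2) = 1 := MvPowerSeries.pderiv_X_self
  rw [eulerForm_apply, dR_oneForm, partialD_neg, partialD_smul, partialD_smul, partialD_mul,
    partialD_mul, h0, h1, mul_one, euler_apply]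
  congr 1
  module

/-- A surjection `R → M` with kernel `J` induces an isomorphism `R ⧸ J ≃ M`. -/
theorem exists_equiv_of_ker_eq {M : Type*} [AddCommGroup M] [Module PS2 M] {J : Ideal PS2}
    (ψ : PS2 →ₗ[PS2] M) (hψ : Function.Surjective ψ) (hJ : ∀ h, ψ h = 0 ↔ h ∈ J) :
    ∃ e : (PS2 ⧸ J) ≃ₗ[PS2] M, ∀ h, e (Ideal.Quotient.mk J h) = ψ h := by
  have hk : J = LinearMap.ker ψ := by
    ext h
    rw [LinearMap.mem_ker, hJ]
  exact ⟨(Submodule.quotEquivOfEq _ _ hk).trans (ψ.quotKerEquivOfSurjective hψ), fun _ => rfl⟩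

theorem exists_eta {f : PS2} (hf : f ∈ jacobianIdeal f) (m : ℕ) :
    ∃ η : Milnor f ≃ₗ[PS2] HExt f (m + 2) (-m),
      ∀ h, Represents f (m + 2) (-m) (twoForm h m) (η (toMilnor f h)) := by
  have h₂ (h : PS2) : del f (volumeForm m h) ∈ dgIdeal f := by
    rw [show del f (volumeForm m h) = 0 from del_twoForm f h m]
    exact zero_mem _
  have hrep (h : PS2) : Represents f (m + 2) (-m) (twoForm h m) _ :=
    represents_classMap (φ := volumeForm m) (fun h => twoForm_mem_piece h m) h₂ h
  obtain ⟨η, hη⟩ := exists_equiv_of_ker_eq (J := jacobianIdeal f)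
    (classMap f (m + 2) (-m) (volumeForm m) (fun h => twoForm_mem_piece h m) h₂)
    (fun x => by
      obtain ⟨h, hx⟩ := exists_represents_twoForm x
      exact ⟨h, (hrep h).unique hx⟩)
    (fun h => by
      have h0 : Represents f (m + 2) (-m) (twoForm 0 m) 0 := by
        rw [twoForm, mono_zero]
        exact represents_zero _ _ _
      rw [(hrep h).twoForm_eq_iff hf h0, sub_zero])
  exact ⟨η, fun h => by rw [hη]; exact hrep h⟩

/-- Every cocycle `(x du + y dv) γ_{m+1}` of `Ω_S ⊗_S A` is the sum of a multiple of the Euler form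
and of a multiple of `df`. -/
theorem Represents.exists_decomposition {a b : ℂ} {f : PS2} (hf : euler a b f = f) {N : ℕ}
    (hN : ∀ i : Fin 2, (MvPowerSeries.X i : PS2) ^ N ∈ jacobianIdeal f) {q m : ℕ} {n : ℤ}
    {x y : PS2} {z : HExt f q n} (hz : Represents f q n (oneForm x y (m + 1)) z) :
    ∃ k c, x = -(b • (MvPowerSeries.X 1 * k)) + c * partialD 0 f ∧
      y = a • (MvPowerSeries.X 0 * k) + c * partialD 1 f := by
  obtain ⟨k, hk⟩ := hz.oneForm_dvd
  have h1 := euler_form_wedge hf k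
  obtain ⟨c, h2, h3⟩ := exists_eq_mul_of_syzygy hN
    (show partialD 0 f * (y - a • (MvPowerSeries.X 0 * k)) =
      partialD 1 f * (x - -(b • (MvPowerSeries.X 1 * k))) by linear_combination hk - h1)
  exact ⟨k, c, by rw [← h3]; ring, by rw [← h2]; ring⟩

theorem exists_theta {a b : ℂ} {f : PS2} (hf : euler a b f = f) (hf0 : f ≠ 0) {N : ℕ}
    (hN : ∀ i : Fin 2, (MvPowerSeries.X i : PS2) ^ N ∈ jacobianIdeal f) (m : ℕ) :
    ∃ θ : Milnor f ≃ₗ[PS2] HExt f (m + 1 + 1) (-(m + 1 : ℕ)),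
      ∀ h, Represents f (m + 1 + 1) (-(m + 1 : ℕ)) (eulerForm a b (m + 1) h)
        (θ (toMilnor f h)) := by
  have h₂ (h : PS2) : del f (eulerForm a b (m + 1) h) ∈ dgIdeal f := by
    rw [del_eulerForm hf]
    exact neg_mem (twoForm_mem_dgIdeal.2 (Dvd.intro _ rfl))
  have hrep (h : PS2) : Represents f (m + 1 + 1) (-(m + 1 : ℕ)) (eulerForm a b (m + 1) h) _ :=
    represents_classMap (fun h => oneForm_mem_piece _ _ (m + 1)) h₂ h
  obtain ⟨θ, hθ⟩ := exists_equiv_of_ker_eq (J := jacobianIdeal f)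
    (classMap f (m + 1 + 1) (-(m + 1 : ℕ)) (eulerForm a b (m + 1))
      (fun h => oneForm_mem_piece _ _ (m + 1)) h₂)
    (fun z => by
      obtain ⟨x, y, hz⟩ := exists_represents_oneForm z
      obtain ⟨k, c, hx, hy⟩ := hz.exists_decomposition hf hN
      refine ⟨k, ((hrep k).oneForm_eq_iff hz).2 ⟨c, ?_, ?_⟩⟩
      · exact ⟨0, by rw [hx]; ring⟩
      · exact ⟨0, by rw [hy]; ring⟩)
    (fun h => by
      have h0 : Represents f (m + 1 + 1) (-(m + 1 : ℕ)) (oneForm 0 0 (m + 1)) 0 := by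
        rw [oneForm, mono_zero, mono_zero, add_zero]
        exact represents_zero _ _ _
      rw [(hrep h).oneForm_eq_iff h0, mem_jacobianIdeal]
      have hE := euler_form_wedge hf h
      constructor
      · rintro ⟨c, ⟨s, hs⟩, ⟨t, ht⟩⟩
        -- Wedging hα + c df = f (s du + t dv) with df removes c and leaves fh = f (t f_u - s f_v).
        refine ⟨t, -s, mul_left_cancel₀ hf0 ?_⟩
        linear_combination hE - partialD 0 f * ht + partialD 1 f * hs
      · rintro ⟨x, y, rfl⟩
        rw [euler_apply] at hf
        simp only [MvPowerSeries.smul_eq_C_mul] at hf ⊢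
        -- For h = x f_u + y f_v this c gives hα + c df = f (x dv - y du), by Ef = f.
        refine ⟨x * (MvPowerSeries.C b * MvPowerSeries.X 1) -
          y * (MvPowerSeries.C a * MvPowerSeries.X 0), ⟨-y, ?_⟩, ⟨x, ?_⟩⟩
        · linear_combination -y * hf
        · linear_combination x * hf)
  exact ⟨θ, fun h => by rw [hθ]; exact hrep h⟩

/-! ### The de Rham differential on classes -/

theorem dRH_mkHForm {f : PS2} {q : ℕ} {n : ℤ} {ω : Form} (h₁ : ω ∈ piece q n)
    (h₂ : del f ω = 0) : dRH f q n (mkHForm f q n ω h₁ h₂) =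
      mkHForm f (q + 1) n (dR ω) (dR_piece h₁) (by rw [← neg_eq_zero, ← dR_del, h₂, map_zero]) :=
  rfl

/-- On the class of `h` times the Euler form, the de Rham differential is given by the operator
`euler a b + (a + b + m + 1)`. -/
theorem represents_red_dRH {a b : ℂ} {f : PS2} (hf : euler a b f = f) (hf0 : f ≠ 0) {m : ℕ}
    {x : HForm f (m + 1 + 1) (-(m + 1 : ℕ))} {h : PS2}
    (hx : Represents f (m + 1 + 1) (-(m + 1 : ℕ)) (eulerForm a b (m + 1) h)
      (red f (m + 1 + 1) (-(m + 1 : ℕ)) x)) :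
    Represents f (m + 1 + 2) (-(m + 1 : ℕ))
      (twoForm (euler a b h + (a + b + (m + 1 : ℕ) : ℂ) • h) (m + 1))
      (red f (m + 1 + 2) (-(m + 1 : ℕ)) (dRH f (m + 1 + 1) (-(m + 1 : ℕ)) x)) := by
  -- The ε-term cancels ∂ of the Euler form, which is zero only modulo f; its de Rham differential
  -- supplies the extra m + 1.
  set ω : Form := eulerForm a b (m + 1) h + mono {0, 1, 2} m h with hω
  have h₁ : ω ∈ piece (m + 1 + 1) (-(m + 1 : ℕ)) := by
    refine add_mem (oneForm_mem_piece _ _ (m + 1)) ?_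
    have := mono_top_mem_piece h m
    push_cast
    exact this
  have h₂ : del f ω = 0 := by
    rw [hω, map_add, del_eulerForm hf, del_mono_top, neg_add_cancel]
  have hK : ω - eulerForm a b (m + 1) h ∈ dgIdeal f := by
    rw [hω, add_sub_cancel_left]
    intro I hI k
    have hne : I ≠ {0, 1, 2} := by
      rintro rfl
      exact hI (by decide)
    simp [mono_apply, hne]
  obtain rfl : mkHForm f _ _ ω h₁ h₂ = x :=
    (red_bijective hf0 _ _).1 (((represents_red h₁ h₂).congr hK).unique hx)
  rw [dRH_mkHForm]
  have hd : dR ω = twoForm (euler a b h + (a + b + (m + 1 : ℕ) : ℂ) • h) (m + 1) := by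
    rw [hω, map_add, dR_eulerForm, dR_mono_top, ← twoForm_add]
    congr 1
    simp only [MvPowerSeries.smul_eq_C_mul, map_add, map_natCast]
    push_cast
    ring
  rw [← hd]
  exact represents_red _ _

end KoszulDeRham

/-! ### Assembling the theorem -/

theorem PS2.IsWeightedHomogeneous.euler_div {f : PS2} {w : Fin 2 → ℚ} {d : ℚ} (hd : d ≠ 0)
    (hf : IsWeightedHomogeneous w d f) :
    euler ((w 0 / d : ℚ) : ℂ) ((w 1 / d : ℚ) : ℂ) f = f := by
  have h : IsWeightedHomogeneous ![w 0 / d, w 1 / d] 1 f := by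
    intro m hm
    simp only [Matrix.cons_val_zero, Matrix.cons_val_one]
    rw [← mul_div_assoc, ← mul_div_assoc, ← add_div, hf m hm, div_self hd]
  simpa using h.euler_eq

theorem PS2.IsIsolatedSingularity.ne_zero {f : PS2} (hs : IsIsolatedSingularity f) : f ≠ 0 := by
  rintro rfl
  obtain ⟨N, hN⟩ := hs.exists_X_pow_mem (zero_mem _)
  obtain ⟨a, b, h⟩ := mem_jacobianIdeal.1 (hN 0)
  simp only [partialD, map_zero, mul_zero, add_zero] at h
  simpa [MvPowerSeries.X_pow_eq] using
    congrArg (MvPowerSeries.coeff (Finsupp.single (0 : Fin 2) N)) h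

end

theorem mainTheorem7 (f : PS2) (w : Fin 2 → ℚ) (d : ℚ) (hw : ∀ i, 0 < w i) (hd : 0 < d)
    (hf : IsWeightedHomogeneous w d f) (hsing : IsIsolatedSingularity f)
    (p : ℕ) (hp : 1 ≤ p)
    -- the normalized weights, for which `f` has weighted degree `1`
    (w₁ w₂ : ℚ) (hw₁ : w₁ = w 0 / d) (hw₂ : w₂ = w 1 / d) :
    -- `Ω^q_S → ⋀^q L_A` is a quasi-isomorphism
    (∀ (q : ℕ) (n : ℤ), Function.Bijective (red f q n)) ∧
    -- `M_f` is the direct sum of its weighted pieces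
    DirectSum.IsInternal (fun c : ℚ => milnorPiece f ![w₁, w₂] c) ∧
    ∃ (θ : Milnor f ≃ₗ[PS2] HExt f (p + 1) (-p)) (η : Milnor f ≃ₗ[PS2] HExt f (p + 2) (-p)),
      -- `θ [h] = [h (w₁ u dv - w₂ v du) γ_p]` and `η [h] = [h du dv γ_p]`
      (∀ h : PS2, Represents f (p + 1) (-p)
        (oneForm (-((w₂ : ℂ) • (MvPowerSeries.X 1 * h))) ((w₁ : ℂ) • (MvPowerSeries.X 0 * h)) p)
        (θ (toMilnor f h))) ∧
      (∀ h : PS2, Represents f (p + 2) (-p) (twoForm h p) (η (toMilnor f h))) ∧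
      -- the de Rham differential
      (∃ d₁ : HExt f (p + 1) (-p) ≃ₗ[ℂ] HExt f (p + 2) (-p),
        (∀ x : HForm f (p + 1) (-p), d₁ (red f (p + 1) (-p) x) =
          red f (p + 2) (-p) (dRH f (p + 1) (-p) x)) ∧
        ∀ c : ℚ, ∀ m ∈ milnorPiece f ![w₁, w₂] c,
          d₁ (θ m) = ((c + w₁ + w₂ + p : ℚ) : ℂ) • η m) ∧
      -- the map induced by `(a du + b dv) γ_p ↦ (b_u - a_v) du dv γ_p`
      (∃ δ : HExt f (p + 1) (-p) ≃ₗ[ℂ] HExt f (p + 2) (-p),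
        (∀ (a b : PS2) (x : HExt f (p + 1) (-p)), Represents f (p + 1) (-p) (oneForm a b p) x →
          Represents f (p + 2) (-p) (twoForm (partialD 0 b - partialD 1 a) p) (δ x)) ∧
        ∀ c : ℚ, ∀ m ∈ milnorPiece f ![w₁, w₂] c,
          δ (θ m) = ((c + w₁ + w₂ : ℚ) : ℂ) • η m) := by
  obtain ⟨m, rfl⟩ : ∃ m, p = m + 1 := ⟨p - 1, by omega⟩
  have hw₁0 : 0 < w₁ := hw₁ ▸ div_pos (hw 0) hd
  have hw₂0 : 0 < w₂ := hw₂ ▸ div_pos (hw 1) hd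
  have hE : euler (w₁ : ℂ) (w₂ : ℂ) f = f := by
    rw [hw₁, hw₂]
    exact hf.euler_div hd.ne'
  have hf0 : f ≠ 0 := hsing.ne_zero
  have hJ : f ∈ jacobianIdeal f := mem_jacobianIdeal_of_euler hE
  obtain ⟨N, hN⟩ := hsing.exists_X_pow_mem hJ
  have htop := iSup_milnorPiece hN ![w₁, w₂]
  obtain ⟨θ, hθ⟩ := exists_theta hE hf0 hN m
  obtain ⟨η, hη⟩ := exists_eta hJ (m + 1)
  let T (s : ℚ) (hs : 0 < s) : Milnor f ≃ₗ[ℂ] Milnor f :=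
    LinearEquiv.ofBijective (milnorEuler hE (s : ℂ))
      (milnorEuler_bijective hE hw₁0.le hw₂0.le htop hs)
  have hT (s : ℚ) (hs : 0 < s) (h : PS2) :
      T s hs (toMilnor f h) = toMilnor f (euler w₁ w₂ h + (s : ℂ) • h) := rfl
  -- Both maps are transports of E + s through θ and η: s = w₁ + w₂ + p for the de Rham
  -- differential, s = w₁ + w₂ for the coefficientwise one.
  let D (s : ℚ) (hs : 0 < s) :
      HExt f (m + 1 + 1) (-(m + 1 : ℕ)) ≃ₗ[ℂ] HExt f (m + 1 + 2) (-(m + 1 : ℕ)) :=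
    ((θ.restrictScalars ℂ).symm.trans (T s hs)).trans (η.restrictScalars ℂ)
  have hD (s : ℚ) (hs : 0 < s) (x : Milnor f) : D s hs (θ x) = η (T s hs x) :=
    congrArg (fun y => η (T s hs y)) (θ.symm_apply_apply x)
  have hDpiece (s : ℚ) (hs : 0 < s) (c : ℚ) (x : Milnor f)
      (hx : x ∈ milnorPiece f ![w₁, w₂] c) : D s hs (θ x) = ((c + s : ℚ) : ℂ) • η x := by
    have h1 : T s hs x = ((c : ℂ) + s) • x := milnorEuler_of_mem hE s hx
    rw [hD s hs, h1]
    push_cast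
    exact (η.restrictScalars ℂ).map_smul _ x
  have hs₁ : 0 < w₁ + w₂ + (m + 1 : ℕ) := by positivity
  have hs₂ : 0 < w₁ + w₂ := by positivity
  refine ⟨red_bijective hf0, DirectSum.isInternal_submodule_of_iSupIndep_of_iSup_eq_top
    (iSupIndep_milnorPiece hE) htop, θ, η, hθ, hη, ⟨D _ hs₁,
      fun x => ?_, fun c x hx => ?_⟩, ⟨D _ hs₂, fun a b x hx => ?_,
      fun c x hx => ?_⟩⟩
  · obtain ⟨y, hy⟩ := θ.surjective (red f (m + 1 + 1) (-(m + 1 : ℕ)) x)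
    obtain ⟨h, rfl⟩ := Ideal.Quotient.mk_surjective y
    have h1 := represents_red_dRH hE hf0 (hy ▸ hθ h)
    rw [← hy, hD _ hs₁, hT _ hs₁]
    refine Represents.unique (hη _) ?_
    push_cast at h1 ⊢
    exact h1
  · rw [hDpiece _ hs₁ c x hx, ← add_assoc, ← add_assoc]
  -- An arbitrary representative is exactly kα + c df, not merely modulo f. The extra term
  -- contributes dc ∧ df, whose coefficient lies in J, so the rule does not depend on the
  -- representative.
  · obtain ⟨k, c, ha, hb⟩ := hx.exists_decomposition hE hN
    obtain rfl : θ (toMilnor f k) = x := ((hθ k).oneForm_eq_iff hx).2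
      ⟨c, ⟨0, by rw [ha]; ring⟩, ⟨0, by rw [hb]; ring⟩⟩
    rw [hD _ hs₂, hT _ hs₂]
    have h1 : toMilnor f (euler w₁ w₂ k + ((w₁ + w₂ : ℚ) : ℂ) • k) =
        toMilnor f (partialD 0 b - partialD 1 a) := by
      have h2 : partialD 0 b - partialD 1 a = euler w₁ w₂ k + ((w₁ + w₂ : ℚ) : ℂ) • k +
          (partialD 0 c * partialD 1 f - partialD 1 c * partialD 0 f) := by
        -- The coefficient of du dv in d(kα); the power of dε plays no role here, so 0 is taken.
        have h3 := congrFun (congrFun (dR_eulerForm w₁ w₂ 0 k) {0, 1}) 0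
        rw [eulerForm_apply, dR_oneForm, twoForm_apply, twoForm_apply] at h3
        rw [ha, hb, partialD_add, partialD_add, partialD_mul, partialD_mul, partialD_comm f]
        push_cast
        rw [← h3]
        ring
      rw [h2, eq_comm, Ideal.Quotient.eq, add_sub_cancel_left]
      exact sub_mem (Ideal.mul_mem_left _ _ (partialD_mem_jacobianIdeal 1 f))
        (Ideal.mul_mem_left _ _ (partialD_mem_jacobianIdeal 0 f))
    rw [h1]
    exact hη _
  · rw [hDpiece _ hs₂ c x hx, ← add_assoc]
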